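/- Let $\sigma,\lambda>0$, put $\mu=1+2\lambda/\sigma$, and let $$f_\infty(v)=\frac{(\mu-1)^\mu}{\Gamma(\mu)}\,\frac{\exp\left(-\frac{\mu-1}{v}\right)}{v^{1+\mu}}\quad (v>0),\qquad f_\infty(v)=0\quad (v\le 0).$$ For integrable $g,h:\mathbb R\to\mathbb R$ and $s>0$ let $\widehat g(\xi)=\int_{\mathbb R}e^{-i\xi v}g(v)\,dv$ and $$D_{s,2}(g,h)=\left[\int_{\mathbb R}|\xi|^{-(2s+1)}\,|\widehat g(\xi)-\widehat h(\xi)|^2\,d\xi\right]^{1/2}\in[0,\infty].$$ Let $f_0$ be a probability density on $\mathbb R$ with finite first moment and $\int_{\mathbb R} v f_0(v)\,dv=1$, and suppose that $D_{s,2}(f_0,f_\infty)<\infty$ for some $s$ with $0<s<\mu$. Let $f(t)=f(\cdot,t)$, $t\ge 0$, be a weak solution on the whole line of the Fokker--Planck equation $$\partial_t f=\frac{\sigma}{2}\,\partial_v^2\left(v^2 f\right)+\lambda\,\partial_v\left((v-1)f\right)$$ with initial datum $f_0$. That is, $f$ is measurable in $(v,t)$; $f(t)\in L^1(\mathbb R)$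 for every $t\ge 0$, with $\|f(t)\|_{L^1}$ bounded for $t$ in bounded intervals; and for all $\varphi\in C_c^\infty(\mathbb R)$ and $t\ge 0$ $$\int_{\mathbb R}\varphi(v)f(v,t)\,dv=\int_{\mathbb R}\varphi(v)f_0(v)\,dv+\int_0^t\int_{\mathbb R}\left[\frac{\sigma}{2}v^2\varphi''(v)-\lambda(v-1)\varphi'(v)\right]f(v,\tau)\,dv\,d\tau.$$ Then $f(t)$ converges exponentially to $f_\infty$ in $D_{s,2}$: the rate $\frac{s}{2}\left((1-s)\sigma+2\lambda\right)$ is positive, and for all $t\ge 0$ $$D_{s,2}(f(t),f_\infty)\le \exp\left\{-\frac{s}{2}\left((1-s)\sigma+2\lambda\right)t\right\}\,D_{s,2}(f_0,f_\infty).$$ -/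

import Mathlib

open MeasureTheory Set
open scoped ENNReal ContDiff

noncomputable section

/-- The Fourier transform `ĝ(ξ) = ∫ e^{-iξv} g(v) dv` of a real function on the line. -/
def fourierTr (g : ℝ → ℝ) (ξ : ℝ) : ℂ :=
  ∫ v : ℝ, Complex.exp (-(Complex.I * (ξ : ℂ) * (v : ℂ))) * (g v : ℂ)

/-- The Fourier-based metric
`D_{s,p}(g, h) = (∫ |ξ|^{-(ps+1)} |ĝ(ξ) - ĥ(ξ)|^p dξ)^{1/p}`, with values in `[0, ∞]`.
(The value of the weight at the single point `ξ = 0` is irrelevant.) -/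
def fourierDist (s p : ℝ) (g h : ℝ → ℝ) : ℝ≥0∞ :=
  (∫⁻ ξ : ℝ, ENNReal.ofReal
    (|ξ| ^ (-(p * s + 1)) * ‖fourierTr g ξ - fourierTr h ξ‖ ^ p)) ^ (1 / p)

/-- The tail exponent `μ = 1 + 2 λ / σ`. -/
def paretoExp (σ lam : ℝ) : ℝ := 1 + 2 * (lam / σ)

/-- The inverse-Gamma equilibrium density, extended by zero to `v ≤ 0`. -/
def equilibrium (σ lam : ℝ) (v : ℝ) : ℝ :=
  if 0 < v then
    (paretoExp σ lam - 1) ^ paretoExp σ lam / Real.Gamma (paretoExp σ lam) *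
      (Real.exp (-((paretoExp σ lam - 1) / v)) / v ^ (1 + paretoExp σ lam))
  else 0

/-- `g` is a probability density on the line with finite mean equal to one. -/
structure IsUnitMeanDensity (g : ℝ → ℝ) : Prop where
  nonneg : ∀ᵐ v : ℝ, 0 ≤ g v
  integrable : Integrable g
  mass : ∫ v : ℝ, g v = 1
  integrable_mean : Integrable (fun v : ℝ => v * g v)
  mean : ∫ v : ℝ, v * g v = 1

/-- Weak (distributional) solutions on the whole line, in the class `L^∞_loc([0,∞); L¹(ℝ))`, of
`∂_t f = (σ/2) ∂_v² (v² f) + λ ∂_v ((v - 1) f)` with initial datum `f₀`. Here `f t v` is the value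
at time `t` and position `v`, and only times `t ≥ 0` matter. The equation is tested, in the form
integrated in time, against all smooth compactly supported functions of `v`; no condition is
imposed at `v = 0`, and neither sign nor mass nor mean of `f t` is prescribed for `t > 0`. -/
structure IsWeakSolution (σ lam : ℝ) (f₀ : ℝ → ℝ) (f : ℝ → ℝ → ℝ) : Prop where
  measurable : AEStronglyMeasurable (Function.uncurry f)
    (((volume : Measure ℝ).restrict (Ici 0)).prod (volume : Measure ℝ))
  integrable : ∀ t : ℝ, 0 ≤ t → Integrable (f t)
  bounded : ∀ T : ℝ, ∃ C : ℝ, ∀ t ∈ Icc 0 T, ∫ v : ℝ, |f t v| ≤ C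
  weak : ∀ φ : ℝ → ℝ, ContDiff ℝ ∞ φ → HasCompactSupport φ → ∀ t : ℝ, 0 ≤ t →
    ∫ v : ℝ, φ v * f t v = (∫ v : ℝ, φ v * f₀ v) +
      ∫ τ in (0 : ℝ)..t, ∫ v : ℝ,
        (σ / 2 * v ^ 2 * deriv (deriv φ) v - lam * (v - 1) * deriv φ v) * f τ v

end

/-! The equation is the forward equation of dV = -λ(V - 1) dt + √σ V dW, whose backward operator is
`kolmogorov`. Over a time step h this diffusion is imitated by the two-point walk v ↦ e^l v + λh
with l = -(λ + σ/2)h ± √(σh), where σ/2 is Itô's correction for log V.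

Duality identifies an arbitrary weak solution. `walkStep` agrees with 1 + h L, L the backward
operator, up to O(h^(3/2)) (`exists_walkStep_consistency`), and the norms in `WeightedBound` grow by
at most e^(Ch) per step. They control both the Taylor remainder and L²u. Hence n steps of size t/n,
tested against f₀, tend to the test of f(t): no regularity of the backward semigroup is needed. A
first-moment bound on the walk prevents loss of mass at infinity, so the convergence extends to
characters and gives pointwise convergence of Fourier transforms.

On the Fourier side a step averages two dilations of G multiplied by a phase (`fourierStep`).
Dilation by a multiplies the weighted L² norm by a^s, and the mean of a^s is at most exp(-(s(λ +
σ/2) - s²σ/2)h) because cosh x ≤ e^(x²/2). This is exactly the claimed rate, already at the discrete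
level. The equilibrium has zero flux and so is a stationary weak solution; the same limit applies to
it. Contracting the difference of transforms for n steps and using Fatou's lemma finishes the proof.
-/

noncomputable section

/-! ### The random walk and its stability in weighted norms -/

/-- The average of `u` over the images of a point under the two affine maps `v ↦ a₁ v + b` and
`v ↦ a₂ v + b`. -/
def affineAvg {E : Type*} [AddCommGroup E] [Module ℝ E] (a₁ a₂ b : ℝ) (u : ℝ → E) (v : ℝ) : E :=
  (1 / 2 : ℝ) • (u (a₁ * v + b) + u (a₂ * v + b))

/-- The logarithm of the multiplicative noise of one time step, for the sign `ε = ± 1`. -/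
def logScale (σ lam h ε : ℝ) : ℝ := -(lam + σ / 2) * h + ε * √(σ * h)

/-- One step of the random walk that approximates the backward Kolmogorov semigroup. -/
def walkStep {E : Type*} [AddCommGroup E] [Module ℝ E] (σ lam h : ℝ) (u : ℝ → E) : ℝ → E :=
  affineAvg (Real.exp (logScale σ lam h 1)) (Real.exp (logScale σ lam h (-1))) (lam * h) u

/-- The backward Kolmogorov operator, which appears in the weak formulation. -/
def kolmogorov (σ lam : ℝ) (u : ℝ → ℝ) (v : ℝ) : ℝ :=
  σ / 2 * v ^ 2 * deriv (deriv u) v - lam * (v - 1) * deriv u v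

/-- `K` bounds all `|v|^j |u^(k)(v)|` with `j ≤ k ≤ 4`. -/
def WeightedBound (u : ℝ → ℝ) (K : ℝ) : Prop :=
  ∀ k ≤ 4, ∀ j ≤ k, ∀ v : ℝ, |v| ^ j * |iteratedDeriv k u v| ≤ K

lemma hasCompactSupport_comp_affine {u : ℝ → ℝ} (hu : HasCompactSupport u) {a : ℝ} (ha : a ≠ 0)
    (b : ℝ) : HasCompactSupport (fun v => u (a * v + b)) :=
  hu.comp_homeomorph ((Homeomorph.mulLeft₀ a ha).trans (Homeomorph.addRight b))

lemma contDiff_affineAvg {u : ℝ → ℝ} (hu : ContDiff ℝ ∞ u) (a₁ a₂ b : ℝ) :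
    ContDiff ℝ ∞ (affineAvg a₁ a₂ b u) := by
  unfold affineAvg
  fun_prop

lemma hasCompactSupport_affineAvg {u : ℝ → ℝ} (hu : HasCompactSupport u) {a₁ a₂ : ℝ}
    (h₁ : a₁ ≠ 0) (h₂ : a₂ ≠ 0) (b : ℝ) : HasCompactSupport (affineAvg a₁ a₂ b u) :=
  ((hasCompactSupport_comp_affine hu h₁ b).add (hasCompactSupport_comp_affine hu h₂ b)).smul_left
    (f := fun _ => (1 / 2 : ℝ))

lemma iteratedDeriv_comp_affine {u : ℝ → ℝ} (hu : ContDiff ℝ ∞ u) (k : ℕ) (a b v : ℝ) :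
    iteratedDeriv k (fun v => u (a * v + b)) v = a ^ k * iteratedDeriv k u (a * v + b) := by
  have h1 : ContDiff ℝ k (fun z => u (z + b)) :=
    (hu.of_le (by exact_mod_cast le_top)).comp (by fun_prop)
  have := congrFun (iteratedDeriv_comp_const_mul h1 a) v
  rw [this, iteratedDeriv_comp_add_const]

lemma iteratedDeriv_affineAvg {u : ℝ → ℝ} (hu : ContDiff ℝ ∞ u) (k : ℕ) (a₁ a₂ b v : ℝ) :
    iteratedDeriv k (affineAvg a₁ a₂ b u) v = 1 / 2 *
      (a₁ ^ k * iteratedDeriv k u (a₁ * v + b) + a₂ ^ k * iteratedDeriv k u (a₂ * v + b)) := by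
  have h (a : ℝ) : ContDiffAt ℝ k (fun v => u (a * v + b)) v :=
    ((hu.of_le (by exact_mod_cast le_top)).comp (by fun_prop)).contDiffAt
  unfold affineAvg
  simp only [smul_eq_mul]
  rw [iteratedDeriv_const_mul _ ((h a₁).add (h a₂)), iteratedDeriv_fun_add (h a₁) (h a₂),
    iteratedDeriv_comp_affine hu, iteratedDeriv_comp_affine hu]

lemma WeightedBound.nonneg {u : ℝ → ℝ} {K : ℝ} (h : WeightedBound u K) : 0 ≤ K :=
  (by positivity : (0 : ℝ) ≤ |0| ^ 0 * |iteratedDeriv 0 u 0|).trans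
    (h 0 (by simp) 0 le_rfl 0)

/-- For |x| ≤ 1 the unweighted bound suffices, and for |x| ≥ 1 the shift is absorbed by b ≤ b|x|.
This is why all weights j ≤ k, not only j = k, are kept in `WeightedBound`. -/
lemma WeightedBound.add_pow_mul_le {u : ℝ → ℝ} {K : ℝ} (h : WeightedBound u K) {k j : ℕ}
    (hk : k ≤ 4) (hj : j ≤ k) {b : ℝ} (hb : 0 ≤ b) (x : ℝ) :
    (|x| + b) ^ j * |iteratedDeriv k u x| ≤ (1 + b) ^ j * K := by
  rcases le_total |x| 1 with hx | hx
  · have := h k hk 0 (Nat.zero_le _) x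
    rw [pow_zero, one_mul] at this
    gcongr
  · have h1 : |x| + b ≤ (1 + b) * |x| := by nlinarith
    calc (|x| + b) ^ j * |iteratedDeriv k u x|
        ≤ ((1 + b) * |x|) ^ j * |iteratedDeriv k u x| := by gcongr
      _ = (1 + b) ^ j * (|x| ^ j * |iteratedDeriv k u x|) := by rw [mul_pow, mul_assoc]
      _ ≤ (1 + b) ^ j * K := by gcongr; exact h k hk j hj x

/-- The moments of the multiplicative noise are at most those of geometric Brownian motion. -/
lemma exp_logScale_rpow_avg_le {σ h : ℝ} (lam p : ℝ) (hσ : 0 < σ) (hh : 0 ≤ h) :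
    1 / 2 * (Real.exp (logScale σ lam h 1) ^ p + Real.exp (logScale σ lam h (-1)) ^ p) ≤
      Real.exp (-(p * (lam + σ / 2) - p ^ 2 * σ / 2) * h) := by
  have e (ε : ℝ) : Real.exp (logScale σ lam h ε) ^ p =
      Real.exp (-(p * ((lam + σ / 2) * h))) * Real.exp (ε * (p * √(σ * h))) := by
    rw [← Real.exp_mul, ← Real.exp_add, logScale]
    ring_nf
  calc _ = Real.exp (-(p * ((lam + σ / 2) * h))) * Real.cosh (p * √(σ * h)) := by
        rw [e, e, Real.cosh_eq, one_mul, neg_one_mul]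
        ring
    _ ≤ Real.exp (-(p * ((lam + σ / 2) * h))) * Real.exp ((p * √(σ * h)) ^ 2 / 2) := by
        gcongr
        exact Real.cosh_le_exp_half_sq _
    _ = _ := by
        rw [← Real.exp_add, mul_pow, Real.sq_sqrt (by positivity)]
        congr 1
        ring

/-- Only the variance term m²σ/2 ≤ 8σ can cause growth; the drift has the favourable sign. -/
lemma exp_logScale_pow_avg_le {σ lam h : ℝ} (hσ : 0 < σ) (hlam : 0 < lam) (hh : 0 ≤ h) {m : ℕ}
    (hm : m ≤ 4) :
    1 / 2 * (Real.exp (logScale σ lam h 1) ^ m + Real.exp (logScale σ lam h (-1)) ^ m) ≤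
      Real.exp (8 * σ * h) := by
  have hm' : (m : ℝ) ≤ 4 := by exact_mod_cast hm
  have := exp_logScale_rpow_avg_le lam m hσ hh
  simp only [Real.rpow_natCast] at this
  refine this.trans (Real.exp_le_exp.2 ?_)
  have h2 : (m : ℝ) ^ 2 ≤ 4 ^ 2 := by gcongr
  have h3 : 0 ≤ m * (lam + σ / 2) := by positivity
  gcongr
  nlinarith

/-- The weighted bound grows at most exponentially along the random walk. -/
lemma WeightedBound.walkStep {σ lam h : ℝ} (hσ : 0 < σ) (hlam : 0 < lam) (hh : 0 ≤ h)
    {u : ℝ → ℝ} (hu : ContDiff ℝ ∞ u) {K : ℝ} (hK : WeightedBound u K) :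
    WeightedBound (walkStep σ lam h u) (Real.exp ((8 * σ + 4 * lam) * h) * K) := by
  intro k hk j hj v
  have hb : 0 ≤ lam * h := by positivity
  -- Of the k factors a produced by differentiation, j turn the weight at v into one at the image
  -- point x. The other k - j are left to be averaged over the two signs.
  have key (ε : ℝ) : |v| ^ j * |Real.exp (logScale σ lam h ε) ^ k *
      iteratedDeriv k u (Real.exp (logScale σ lam h ε) * v + lam * h)| ≤
      Real.exp (logScale σ lam h ε) ^ (k - j) * ((1 + lam * h) ^ j * K) := by
    set a := Real.exp (logScale σ lam h ε)
    have ha : 0 < a := Real.exp_pos _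
    set x := a * v + lam * h with hx
    have hav : a * |v| ≤ |x| + lam * h := by
      have : a * |v| = |x - lam * h| := by rw [hx, add_sub_cancel_right, abs_mul, abs_of_pos ha]
      rw [this]
      exact (abs_sub _ _).trans (by rw [abs_of_nonneg hb])
    calc |v| ^ j * |a ^ k * iteratedDeriv k u x|
        = a ^ (k - j) * ((a * |v|) ^ j * |iteratedDeriv k u x|) := by
          rw [abs_mul, abs_of_pos (pow_pos ha k), mul_pow]
          nth_rewrite 1 [← Nat.sub_add_cancel hj]
          rw [pow_add]; ring
      _ ≤ a ^ (k - j) * ((|x| + lam * h) ^ j * |iteratedDeriv k u x|) := by gcongr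
      _ ≤ _ := mul_le_mul_of_nonneg_left (hK.add_pow_mul_le hk hj hb x) (by positivity)
  have hK0 := hK.nonneg
  unfold _root_.walkStep
  rw [iteratedDeriv_affineAvg hu]
  set A₁ := Real.exp (logScale σ lam h 1)
  set A₂ := Real.exp (logScale σ lam h (-1))
  calc _ ≤ |v| ^ j * (1 / 2 * (|A₁ ^ k * iteratedDeriv k u (A₁ * v + lam * h)| +
          |A₂ ^ k * iteratedDeriv k u (A₂ * v + lam * h)|)) := by
        rw [abs_mul, abs_of_pos (by norm_num : (0 : ℝ) < 1 / 2)]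
        gcongr
        exact abs_add_le _ _
    _ ≤ 1 / 2 * (A₁ ^ (k - j) + A₂ ^ (k - j)) * ((1 + lam * h) ^ j * K) := by
        linarith [key 1, key (-1)]
    _ ≤ Real.exp (8 * σ * h) * (Real.exp (4 * lam * h) * K) := by
        gcongr
        · exact exp_logScale_pow_avg_le hσ hlam hh (by omega)
        · calc (1 + lam * h) ^ j ≤ (1 + lam * h) ^ 4 :=
                pow_le_pow_right₀ (by linarith) (hj.trans hk)
            _ ≤ Real.exp (lam * h) ^ 4 := by
                gcongr
                linarith [Real.add_one_le_exp (lam * h)]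
            _ = _ := by rw [← Real.exp_nat_mul]; congr 1; push_cast; ring
    _ = _ := by rw [← mul_assoc, ← Real.exp_add]; congr 2; ring

lemma HasCompactSupport.iteratedDeriv_real {u : ℝ → ℝ} (hu : HasCompactSupport u) (k : ℕ) :
    HasCompactSupport (iteratedDeriv k u) := by
  induction k with
  | zero => simpa using hu
  | succ k ih => rw [iteratedDeriv_succ]; exact ih.deriv

lemma exists_weightedBound {u : ℝ → ℝ} (hu : ContDiff ℝ ∞ u) (hc : HasCompactSupport u) :
    ∃ K, WeightedBound u K := by
  have h (k j : ℕ) : ∃ C, ∀ v : ℝ, |v| ^ j * |iteratedDeriv k u v| ≤ C := by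
    have hcont : Continuous (fun v : ℝ => v ^ j * iteratedDeriv k u v) :=
      (continuous_pow j).mul (hu.continuous_iteratedDeriv k (by exact_mod_cast le_top))
    obtain ⟨C, hC⟩ := hcont.bounded_above_of_compact_support
      ((hc.iteratedDeriv_real k).mul_left)
    exact ⟨C, fun v => by simpa [abs_mul, abs_pow] using hC v⟩
  choose C hC using h
  refine ⟨∑ k ∈ Finset.range 5, ∑ j ∈ Finset.range 5, |C k j|, fun k hk j hj v => ?_⟩
  calc _ ≤ C k j := hC k j v
    _ ≤ |C k j| := le_abs_self _
    _ ≤ ∑ j ∈ Finset.range 5, |C k j| :=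
        Finset.single_le_sum (f := fun j => |C k j|) (fun _ _ => abs_nonneg _) (by simp; omega)
    _ ≤ _ := Finset.single_le_sum (f := fun k => ∑ j ∈ Finset.range 5, |C k j|)
        (fun _ _ => Finset.sum_nonneg fun _ _ => abs_nonneg _) (by simp; omega)

/-! ### Taylor expansion and consistency with the backward operator -/

/-- A third order Taylor estimate on the unit interval, with a crude constant. -/
lemma abs_taylor_two_le {r r₁ r₂ r₃ : ℝ → ℝ} {M : ℝ} (h0 : ∀ x, HasDerivAt r (r₁ x) x)
    (h1 : ∀ x, HasDerivAt r₁ (r₂ x) x) (h2 : ∀ x, HasDerivAt r₂ (r₃ x) x)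
    (hM : ∀ x ∈ Icc (0 : ℝ) 1, |r₃ x| ≤ M) :
    |r 1 - r 0 - r₁ 0 - r₂ 0 / 2| ≤ M := by
  -- Integrating from 0 over an interval of length at most one preserves the bound M; three
  -- integrations give the remainder without the factor 1/6.
  have step (p p' : ℝ → ℝ) (hp : ∀ x, HasDerivAt p (p' x) x) (hp0 : p 0 = 0)
      (hb : ∀ x ∈ Icc (0 : ℝ) 1, |p' x| ≤ M) : ∀ x ∈ Icc (0 : ℝ) 1, |p x| ≤ M := by
    intro x hx
    have h := Convex.norm_image_sub_le_of_norm_hasDerivWithin_le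
      (fun y _ => (hp y).hasDerivWithinAt) hb (convex_Icc 0 1)
      (⟨le_rfl, zero_le_one⟩ : (0 : ℝ) ∈ Icc (0 : ℝ) 1) hx
    rw [hp0, sub_zero, sub_zero, Real.norm_eq_abs, Real.norm_eq_abs, abs_of_nonneg hx.1] at h
    have hM0 : 0 ≤ M := (abs_nonneg _).trans (hb x hx)
    exact h.trans (mul_le_of_le_one_right hM0 hx.2)
  have s2 := step (fun x => r₂ x - r₂ 0) r₃ (fun x => (h2 x).sub_const _) (by simp) hM
  have s1 := step (fun x => r₁ x - r₁ 0 - r₂ 0 * x) (fun x => r₂ x - r₂ 0)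
    (fun x => ((h1 x).sub_const _).sub (by simpa using (hasDerivAt_id x).const_mul (r₂ 0)))
    (by simp) s2
  have s0 := step (fun x => r x - r 0 - r₁ 0 * x - r₂ 0 * (x ^ 2 / 2))
    (fun x => r₁ x - r₁ 0 - r₂ 0 * x)
    (fun x => (((h0 x).sub_const _).sub (by simpa using (hasDerivAt_id x).const_mul (r₁ 0))).sub
      ((((hasDerivAt_id x).pow 2).div_const 2 |>.congr_deriv (by simp)).const_mul (r₂ 0)))
    (by simp) s1
  have := s0 1 ⟨zero_le_one, le_rfl⟩
  convert this using 2
  ring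

lemma hasDerivAt_iteratedDeriv {u : ℝ → ℝ} (hu : ContDiff ℝ ∞ u) (k : ℕ) (x : ℝ) :
    HasDerivAt (iteratedDeriv k u) (iteratedDeriv (k + 1) u x) x := by
  rw [iteratedDeriv_succ]
  exact (hu.differentiable_iteratedDeriv k (by exact_mod_cast WithTop.coe_lt_top k) x).hasDerivAt

/-- Taylor expansion of `u` along an affine map that is close to the identity. -/
lemma abs_affine_taylor_le {u : ℝ → ℝ} (hu : ContDiff ℝ ∞ u) {K : ℝ} (hK : WeightedBound u K)
    {l b ε : ℝ} (hl : |l| ≤ ε) (hb : 0 ≤ b) (hbε : b ≤ ε) (hb1 : b ≤ 1) (v : ℝ) :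
    |u (Real.exp l * v + b) - u v - (l * v + b) * iteratedDeriv 1 u v -
      ((l * v + b) ^ 2 * iteratedDeriv 2 u v + l ^ 2 * v * iteratedDeriv 1 u v) / 2| ≤
      57 * ε ^ 3 * K := by
  have hK0 := hK.nonneg
  have hε : 0 ≤ ε := hb.trans hbε
  -- The path X(x) = e^(lx) v + bx joins v to its image. Its derivatives are bounded by powers of ε
  -- times |X| + 2, so the weights can be evaluated at the moving point X itself.
  let p : ℝ → ℝ := fun x => Real.exp (l * x) * v
  let X : ℝ → ℝ := fun x => p x + b * x
  have hp (x : ℝ) : HasDerivAt p (l * p x) x := by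
    have := (((hasDerivAt_id x).const_mul l).exp).mul_const v
    exact this.congr_deriv (by simp [p]; ring)
  have hX (x : ℝ) : HasDerivAt X (l * p x + b) x :=
    (hp x).add (by simpa using (hasDerivAt_id x).const_mul b)
  have hX' (x : ℝ) : HasDerivAt (fun x => l * p x + b) (l ^ 2 * p x) x :=
    (((hp x).const_mul l).add_const b).congr_deriv (by ring)
  have hX'' (x : ℝ) : HasDerivAt (fun x => l ^ 2 * p x) (l ^ 3 * p x) x :=
    ((hp x).const_mul (l ^ 2)).congr_deriv (by ring)
  have hU (k : ℕ) (x : ℝ) : HasDerivAt (fun x => iteratedDeriv k u (X x))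
      (iteratedDeriv (k + 1) u (X x) * (l * p x + b)) x :=
    (hasDerivAt_iteratedDeriv hu k (X x)).comp x (hX x)
  -- 57 = 3³ + 3·3² + 3: the three terms of the third derivative, with 3 = 1 + b from
  -- `WeightedBound.add_pow_mul_le` at b = 2.
  have T := abs_taylor_two_le (r := fun x => u (X x))
    (r₁ := fun x => iteratedDeriv 1 u (X x) * (l * p x + b))
    (r₂ := fun x => iteratedDeriv 2 u (X x) * (l * p x + b) ^ 2 +
      iteratedDeriv 1 u (X x) * (l ^ 2 * p x))
    (r₃ := fun x => iteratedDeriv 3 u (X x) * (l * p x + b) ^ 3 +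
      3 * (iteratedDeriv 2 u (X x) * ((l * p x + b) * (l ^ 2 * p x))) +
      iteratedDeriv 1 u (X x) * (l ^ 3 * p x)) (M := 57 * ε ^ 3 * K)
    (fun x => by simpa using hU 0 x)
    (fun x => ((hU 1 x).mul (hX' x)).congr_deriv (by ring))
    (fun x => (((hU 2 x).mul ((hX' x).pow 2)).add ((hU 1 x).mul (hX'' x))).congr_deriv
      (by simp only [Pi.pow_apply]; push_cast; ring)) ?_
  · simpa [X, p, mul_comm, add_comm, sub_eq_add_neg, add_assoc, add_left_comm] using T
  · intro x hx
    have hpX : |p x| ≤ |X x| + 1 := by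
      have : p x = X x - b * x := by simp [X]
      rw [this]
      refine (abs_sub _ _).trans (add_le_add le_rfl ?_)
      rw [abs_of_nonneg (mul_nonneg hb hx.1)]
      exact mul_le_one₀ hb1 hx.1 hx.2
    have hd : |l * p x + b| ≤ ε * (|X x| + 2) := by
      refine (abs_add_le _ _).trans ?_
      rw [abs_mul, abs_of_nonneg hb]
      nlinarith [mul_le_mul hl hpX (abs_nonneg _) hε]
    have b3 := hK.add_pow_mul_le (k := 3) (j := 3) (by norm_num) le_rfl zero_le_two (X x)
    have b2 := hK.add_pow_mul_le (k := 2) (j := 2) (by norm_num) le_rfl zero_le_two (X x)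
    have b1 := hK.add_pow_mul_le (k := 1) (j := 1) (by norm_num) le_rfl zero_le_two (X x)
    have e2 : |l ^ 2 * p x| ≤ ε ^ 2 * (|X x| + 2) := by
      rw [abs_mul, abs_pow]; gcongr; linarith
    have e3 : |l ^ 3 * p x| ≤ ε ^ 3 * (|X x| + 2) := by
      rw [abs_mul, abs_pow]; gcongr; linarith
    calc _ ≤ |iteratedDeriv 3 u (X x)| * |l * p x + b| ^ 3 +
          3 * (|iteratedDeriv 2 u (X x)| * (|l * p x + b| * |l ^ 2 * p x|)) +
          |iteratedDeriv 1 u (X x)| * |l ^ 3 * p x| := by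
          refine (abs_add_three _ _ _).trans (le_of_eq ?_)
          simp only [abs_mul, abs_pow]
          norm_num
      _ ≤ |iteratedDeriv 3 u (X x)| * (ε * (|X x| + 2)) ^ 3 +
          3 * (|iteratedDeriv 2 u (X x)| * ((ε * (|X x| + 2)) * (ε ^ 2 * (|X x| + 2)))) +
          |iteratedDeriv 1 u (X x)| * (ε ^ 3 * (|X x| + 2)) := by gcongr
      _ = ε ^ 3 * ((|X x| + 2) ^ 3 * |iteratedDeriv 3 u (X x)| +
          3 * ((|X x| + 2) ^ 2 * |iteratedDeriv 2 u (X x)|) +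
          (|X x| + 2) ^ 1 * |iteratedDeriv 1 u (X x)|) := by ring
      _ ≤ ε ^ 3 * ((1 + 2) ^ 3 * K + 3 * ((1 + 2) ^ 2 * K) + (1 + 2) ^ 1 * K) := by gcongr
      _ ≤ _ := by nlinarith [mul_nonneg (pow_nonneg hε 3) hK0]

lemma kolmogorov_eq_iteratedDeriv (σ lam : ℝ) (u : ℝ → ℝ) (v : ℝ) :
    kolmogorov σ lam u v =
      σ / 2 * v ^ 2 * iteratedDeriv 2 u v - lam * (v - 1) * iteratedDeriv 1 u v := by
  rw [iteratedDeriv_succ, iteratedDeriv_one]; rfl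

lemma contDiff_kolmogorov (σ lam : ℝ) {u : ℝ → ℝ} (hu : ContDiff ℝ ∞ u) :
    ContDiff ℝ ∞ (kolmogorov σ lam u) := by
  have h1 : ContDiff ℝ ∞ (deriv u) := hu.iterate_deriv 1
  have h2 : ContDiff ℝ ∞ (deriv (deriv u)) := hu.iterate_deriv 2
  unfold kolmogorov
  fun_prop

lemma hasCompactSupport_kolmogorov (σ lam : ℝ) {u : ℝ → ℝ} (hu : HasCompactSupport u) :
    HasCompactSupport (kolmogorov σ lam u) :=
  (hu.deriv.deriv.mul_left (f := fun v => σ / 2 * v ^ 2)).sub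
    (hu.deriv.mul_left (f := fun v => lam * (v - 1)))

lemma WeightedBound.abs_pow_mul_le {u : ℝ → ℝ} {K : ℝ} (h : WeightedBound u K) {k j : ℕ}
    (hk : k ≤ 4) (hj : j ≤ k) (v : ℝ) {c : ℝ} (hc : 0 ≤ c) :
    |c * (v ^ j * iteratedDeriv k u v)| ≤ c * K := by
  rw [abs_mul, abs_of_nonneg hc, abs_mul, abs_pow]
  exact mul_le_mul_of_nonneg_left (h k hk j hj v) hc

/-- L²u is a combination of terms v^j u^(k) with j ≤ k ≤ 4, which is what fixes the order 4 in
`WeightedBound`. The constants sum the absolute values of the coefficients, with 7/4 rounded up to 2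
for σ². -/
lemma abs_kolmogorov_kolmogorov_le {σ lam : ℝ} (hσ : 0 < σ) (hlam : 0 < lam) {u : ℝ → ℝ}
    (hu : ContDiff ℝ ∞ u) {K : ℝ} (hK : WeightedBound u K) (v : ℝ) :
    |kolmogorov σ lam (kolmogorov σ lam u) v| ≤ (2 * σ ^ 2 + 5 * (σ * lam) + 6 * lam ^ 2) * K := by
  have hU (k : ℕ) (x : ℝ) := hasDerivAt_iteratedDeriv hu k x
  have hd (x : ℝ) : HasDerivAt (kolmogorov σ lam u)
      (σ / 2 * (2 * x * iteratedDeriv 2 u x + x ^ 2 * iteratedDeriv 3 u x) -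
        lam * (iteratedDeriv 1 u x + (x - 1) * iteratedDeriv 2 u x)) x := by
    have : kolmogorov σ lam u = fun x => σ / 2 * (x ^ 2 * iteratedDeriv 2 u x) -
        lam * ((x - 1) * iteratedDeriv 1 u x) := by
      ext x; rw [kolmogorov_eq_iteratedDeriv]; ring
    rw [this]
    exact (((((hasDerivAt_id x).pow 2).mul (hU 2 x)).const_mul (σ / 2)).sub
      ((((hasDerivAt_id x).sub_const 1).mul (hU 1 x)).const_mul lam)).congr_deriv (by simp)
  have hdd (x : ℝ) : HasDerivAt (deriv (kolmogorov σ lam u))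
      (σ / 2 * (2 * iteratedDeriv 2 u x + 4 * x * iteratedDeriv 3 u x +
        x ^ 2 * iteratedDeriv 4 u x) -
        lam * (2 * iteratedDeriv 2 u x + (x - 1) * iteratedDeriv 3 u x)) x := by
    rw [show deriv (kolmogorov σ lam u) = _ from funext fun x => (hd x).deriv]
    exact ((((((hasDerivAt_id x).const_mul 2).mul (hU 2 x)).add
      (((hasDerivAt_id x).pow 2).mul (hU 3 x))).const_mul (σ / 2)).sub
      (((hU 1 x).add (((hasDerivAt_id x).sub_const 1).mul (hU 2 x))).const_mul lam)).congr_deriv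
      (by simp; ring)
  have m {k j : ℕ} (hk : k ≤ 4) (hj : j ≤ k) {c : ℝ} (hc : 0 ≤ c) :=
    abs_le.1 (hK.abs_pow_mul_le hk hj v hc)
  have c1 : 0 ≤ σ ^ 2 := by positivity
  have c2 : 0 ≤ σ * lam := by positivity
  have c3 : 0 ≤ lam ^ 2 := by positivity
  have hK0 := mul_nonneg c1 hK.nonneg
  have a22 := m (k := 2) (j := 2) (by norm_num) (by norm_num) c1
  have a33 := m (k := 3) (j := 3) (by norm_num) (by norm_num) c1
  have a44 := m (k := 4) (j := 4) (by norm_num) (by norm_num) c1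
  have b21 := m (k := 2) (j := 1) (by norm_num) (by norm_num) c2
  have b22 := m (k := 2) (j := 2) (by norm_num) (by norm_num) c2
  have b33 := m (k := 3) (j := 3) (by norm_num) (by norm_num) c2
  have b32 := m (k := 3) (j := 2) (by norm_num) (by norm_num) c2
  have d11 := m (k := 1) (j := 1) (by norm_num) (by norm_num) c3
  have d10 := m (k := 1) (j := 0) (by norm_num) (by norm_num) c3
  have d22 := m (k := 2) (j := 2) (by norm_num) (by norm_num) c3
  have d21 := m (k := 2) (j := 1) (by norm_num) (by norm_num) c3
  have d20 := m (k := 2) (j := 0) (by norm_num) (by norm_num) c3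
  rw [kolmogorov, (hdd v).deriv, (hd v).deriv]
  rw [abs_le]
  constructor <;> linarith

/-- Averaging over the sign cancels the terms of order √h, and the mean of l² is σh + O(h²). The
resulting term (σ/2) h v u' cancels Itô's correction in the drift, leaving h L u. The cubic
remainder is O(h^(3/2)), small enough to be summed over t/h steps. -/
lemma exists_walkStep_consistency {σ lam : ℝ} (hσ : 0 < σ) (hlam : 0 < lam) :
    ∃ c : ℝ, 0 ≤ c ∧ ∀ (u : ℝ → ℝ) (K h : ℝ), ContDiff ℝ ∞ u → WeightedBound u K → 0 ≤ h →
      h ≤ 1 → lam * h ≤ 1 → ∀ v, |walkStep σ lam h u v - u v - h * kolmogorov σ lam u v| ≤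
        c * (h * √h) * K := by
  set κ := lam + σ / 2 with hκ
  have hκ0 : 0 < κ := by positivity
  -- Since h ≤ √h, both |l| and the shift λh are at most A√h, the ε of the Taylor estimate.
  set A := κ + √σ + lam with hA
  refine ⟨57 * A ^ 3 + (κ ^ 2 + κ * lam + lam ^ 2), by positivity,
    fun u K h hu hK hh h1 hlh v => ?_⟩
  have hK0 := hK.nonneg
  have hs : √h ^ 2 = h := Real.sq_sqrt hh
  have hs0 := Real.sqrt_nonneg h
  have hs1 : √h ≤ 1 := Real.sqrt_le_one.2 h1
  have hsh : h ≤ √h := by nlinarith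
  have hsσ : √(σ * h) = √σ * √h := Real.sqrt_mul hσ.le h
  have hsq : √(σ * h) ^ 2 = σ * h := Real.sq_sqrt (by positivity)
  have hl (ε : ℝ) (hε : |ε| = 1) : |logScale σ lam h ε| ≤ A * √h := by
    rw [logScale, ← hκ]
    refine (abs_add_le _ _).trans ?_
    rw [abs_mul, abs_mul, hε, one_mul, abs_neg, abs_of_pos hκ0, abs_of_nonneg hh,
      abs_of_nonneg (Real.sqrt_nonneg _), hsσ, hA]
    nlinarith [mul_le_mul_of_nonneg_left hsh hκ0.le, mul_nonneg hlam.le hs0]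
  have hb0 : 0 ≤ lam * h := by positivity
  have hbA : lam * h ≤ A * √h := by
    rw [hA]
    nlinarith [mul_le_mul_of_nonneg_left hsh hlam.le, mul_nonneg hκ0.le hs0,
      mul_nonneg (Real.sqrt_nonneg σ) hs0]
  have T (ε : ℝ) (hε : |ε| = 1) := abs_affine_taylor_le hu hK (hl ε hε) hb0 hbA hlh v
  have T1 := T 1 (by simp)
  have T2 := T (-1) (by simp)
  set r₁ := u (Real.exp (logScale σ lam h 1) * v + lam * h)
  set r₂ := u (Real.exp (logScale σ lam h (-1)) * v + lam * h)
  set u₁ := iteratedDeriv 1 u v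
  set u₂ := iteratedDeriv 2 u v
  -- The h² part of the averaged second-order terms; the powers `v ^ 1` and `v ^ 0` match
  -- `WeightedBound.abs_pow_mul_le`.
  set Q := 1 / 2 * (κ ^ 2 * (v ^ 2 * u₂)) - κ * lam * (v ^ 1 * u₂) +
    1 / 2 * (lam ^ 2 * (v ^ 0 * u₂)) + 1 / 2 * (κ ^ 2 * (v ^ 1 * u₁)) with hQ
  have hQK : |Q| ≤ (κ ^ 2 + κ * lam + lam ^ 2) * K := by
    have e1 := abs_le.1 (hK.abs_pow_mul_le (k := 2) (j := 2) (by norm_num) le_rfl v (sq_nonneg κ))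
    have e2 := abs_le.1 (hK.abs_pow_mul_le (k := 2) (j := 1) (by norm_num) (by norm_num) v
      (mul_pos hκ0 hlam).le)
    have e3 := abs_le.1 (hK.abs_pow_mul_le (k := 2) (j := 0) (by norm_num) (by norm_num) v
      (sq_nonneg lam))
    have e4 := abs_le.1 (hK.abs_pow_mul_le (k := 1) (j := 1) (by norm_num) le_rfl v (sq_nonneg κ))
    have e5 : 0 ≤ lam ^ 2 * K := by positivity
    rw [abs_le]
    constructor <;> linarith
  have split : walkStep σ lam h u v - u v - h * kolmogorov σ lam u v =
      1 / 2 * (r₁ - u v - (logScale σ lam h 1 * v + lam * h) * u₁ -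
        ((logScale σ lam h 1 * v + lam * h) ^ 2 * u₂ + logScale σ lam h 1 ^ 2 * v * u₁) / 2) +
      1 / 2 * (r₂ - u v - (logScale σ lam h (-1) * v + lam * h) * u₁ -
        ((logScale σ lam h (-1) * v + lam * h) ^ 2 * u₂ +
          logScale σ lam h (-1) ^ 2 * v * u₁) / 2) + h ^ 2 * Q := by
    rw [kolmogorov_eq_iteratedDeriv]
    change 1 / 2 * (r₁ + r₂) - u v - _ = _
    simp only [logScale, ← hκ]
    have hσκ : σ = 2 * (κ - lam) := by rw [hκ]; ring
    linear_combination (v ^ 2 * u₂ / 2 + v * u₁ / 2) * hsq + (h * v * u₁ / 2) * hσκ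
  have hh2 : h ^ 2 ≤ h * √h := by nlinarith
  have h3 : (A * √h) ^ 3 = A ^ 3 * (h * √h) := by rw [mul_pow, pow_succ (√h), hs]
  rw [h3] at T1 T2
  have hlast : |h ^ 2 * Q| ≤ (h * √h) * ((κ ^ 2 + κ * lam + lam ^ 2) * K) := by
    rw [abs_mul, abs_of_nonneg (sq_nonneg h)]
    gcongr
  rw [split]
  refine (abs_add_three _ _ _).trans ?_
  rw [abs_mul, abs_mul, abs_of_pos (by norm_num : (0 : ℝ) < 1 / 2)]
  linarith

/-! ### Weak solutions as limits of the walk on test functions -/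

lemma abs_integral_mul_le {ψ g : ℝ → ℝ} {M : ℝ} (hψ : ∀ v, |ψ v| ≤ M) (hg : Integrable g) :
    |∫ v, ψ v * g v| ≤ M * ∫ v, |g v| := by
  rw [← integral_const_mul, ← Real.norm_eq_abs]
  refine norm_integral_le_of_norm_le (hg.abs.const_mul M) (ae_of_all _ fun v => ?_)
  rw [norm_mul, Real.norm_eq_abs, Real.norm_eq_abs]
  exact mul_le_mul_of_nonneg_right (hψ v) (abs_nonneg _)

lemma integrable_mul_of_bounded {ψ g : ℝ → ℝ} (hc : Continuous ψ) {M : ℝ} (hψ : ∀ v, |ψ v| ≤ M)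
    (hg : Integrable g) : Integrable (fun v => ψ v * g v) :=
  hg.bdd_mul hc.aestronglyMeasurable (ae_of_all _ hψ)

lemma integrable_testFun_mul {u g : ℝ → ℝ} (hu : ContDiff ℝ ∞ u) (hc : HasCompactSupport u)
    (hg : Integrable g) : Integrable (fun v => u v * g v) := by
  obtain ⟨M, hM⟩ := hc.exists_bound_of_continuous hu.continuous
  exact integrable_mul_of_bounded hu.continuous hM hg

namespace IsWeakSolution

variable {σ lam : ℝ} {f₀ : ℝ → ℝ} {f : ℝ → ℝ → ℝ}

lemma intervalIntegrable (hf : IsWeakSolution σ lam f₀ f) {ψ : ℝ → ℝ} (hc : Continuous ψ) {M : ℝ}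
    (hψ : ∀ v, |ψ v| ≤ M) {a b : ℝ} (ha : 0 ≤ a) (hb : 0 ≤ b) :
    IntervalIntegrable (fun τ => ∫ v, ψ v * f τ v) volume a b := by
  have hM : 0 ≤ M := (abs_nonneg _).trans (hψ 0)
  obtain ⟨C, hC⟩ := hf.bounded (max a b)
  have hsub : uIoc a b ⊆ Ici 0 := fun x hx => (le_min ha hb).trans hx.1.le
  have hmeas : AEStronglyMeasurable (fun τ => ∫ v, ψ v * f τ v) (volume.restrict (Ici 0)) := by
    have : AEStronglyMeasurable (fun p : ℝ × ℝ => ψ p.2 * f p.1 p.2)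
        (((volume : Measure ℝ).restrict (Ici 0)).prod (volume : Measure ℝ)) :=
      (hc.comp continuous_snd).aestronglyMeasurable.mul hf.measurable
    exact this.integral_prod_right'
  rw [intervalIntegrable_iff]
  refine IntegrableOn.of_bound (by simp [uIoc]) (hmeas.mono_measure
    (Measure.restrict_mono hsub le_rfl)) (M * C) ?_
  refine (ae_restrict_iff' measurableSet_uIoc).2 (ae_of_all _ fun τ hτ => ?_)
  have hτ0 : 0 ≤ τ := hsub hτ
  exact (abs_integral_mul_le hψ (hf.integrable τ hτ0)).trans
    (mul_le_mul_of_nonneg_left (hC τ ⟨hτ0, hτ.2⟩) hM)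

lemma integral_sub_eq (hf : IsWeakSolution σ lam f₀ f) {u : ℝ → ℝ} (hu : ContDiff ℝ ∞ u)
    (hc : HasCompactSupport u) {a b : ℝ} (ha : 0 ≤ a) (hb : 0 ≤ b) :
    (∫ v, u v * f b v) - ∫ v, u v * f a v = ∫ τ in a..b, ∫ v, kolmogorov σ lam u v * f τ v := by
  obtain ⟨M, hM⟩ := (hasCompactSupport_kolmogorov σ lam hc).exists_bound_of_continuous
    (contDiff_kolmogorov σ lam hu).continuous
  have hi {x y : ℝ} (hx : 0 ≤ x) (hy : 0 ≤ y) :=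
    hf.intervalIntegrable (contDiff_kolmogorov σ lam hu).continuous hM hx hy
  rw [hf.weak u hu hc a ha, hf.weak u hu hc b hb, add_sub_add_left_eq_sub]
  exact intervalIntegral.integral_interval_sub_left (hi le_rfl hb) (hi le_rfl ha)

/-- Over a short time step a weak solution follows the adjoint of the random walk, up to an error of
order `h ^ (3 / 2)`. -/
lemma exists_abs_step_le (hσ : 0 < σ) (hlam : 0 < lam) (hf : IsWeakSolution σ lam f₀ f) (T : ℝ) :
    ∃ c : ℝ, 0 ≤ c ∧ ∀ (u : ℝ → ℝ) (K h t : ℝ), ContDiff ℝ ∞ u → HasCompactSupport u →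
      WeightedBound u K → 0 ≤ h → h ≤ 1 → lam * h ≤ 1 → 0 ≤ t → t + h ≤ T →
      |(∫ v, u v * f (t + h) v) - ∫ v, walkStep σ lam h u v * f t v| ≤ c * (h * √h) * K := by
  obtain ⟨C, hC⟩ := hf.bounded T
  obtain ⟨c, hc0, hcons⟩ := exists_walkStep_consistency hσ hlam
  set D := 2 * σ ^ 2 + 5 * (σ * lam) + 6 * lam ^ 2 with hD
  have hD0 : 0 ≤ D := by positivity
  refine ⟨(D + c) * |C|, by positivity, fun u K h t hu hcu hK hh h1 hlh ht hT => ?_⟩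
  have hK0 := hK.nonneg
  have hLu := contDiff_kolmogorov σ lam hu
  have hLc := hasCompactSupport_kolmogorov σ lam hcu
  have hWu : ContDiff ℝ ∞ (walkStep σ lam h u) := contDiff_affineAvg hu _ _ _
  have hWc : HasCompactSupport (walkStep σ lam h u) :=
    hasCompactSupport_affineAvg hcu (Real.exp_ne_zero _) (Real.exp_ne_zero _) _
  have hft := hf.integrable t ht
  have hCt (τ : ℝ) (hτ : τ ∈ Icc t (t + h)) : ∫ v, |f τ v| ≤ |C| :=
    (hC τ ⟨ht.trans hτ.1, hτ.2.trans hT⟩).trans (le_abs_self C)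
  have hsq : h ^ 2 ≤ h * √h := by
    have h2 : √h ≤ 1 := Real.sqrt_le_one.2 h1
    have h3 : h ≤ √h := by nlinarith [Real.sq_sqrt hh, Real.sqrt_nonneg h]
    nlinarith
  -- L u is itself a test function, so the weak equation applied to it makes τ ↦ ∫ L u f(τ)
  -- Lipschitz.
  have hlip (τ : ℝ) (hτ : τ ∈ Icc t (t + h)) :
      |(∫ v, kolmogorov σ lam u v * f τ v) - ∫ v, kolmogorov σ lam u v * f t v| ≤
        D * K * |C| * h := by
    rw [hf.integral_sub_eq hLu hLc ht (ht.trans hτ.1)]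
    have hb := intervalIntegral.norm_integral_le_of_norm_le_const (a := t) (b := τ)
      (f := fun r => ∫ v, kolmogorov σ lam (kolmogorov σ lam u) v * f r v) (C := D * K * |C|)
      (fun r hr => by
        rw [uIoc_of_le hτ.1] at hr
        have hr' : r ∈ Icc t (t + h) := ⟨hr.1.le, hr.2.trans hτ.2⟩
        exact (abs_integral_mul_le (abs_kolmogorov_kolmogorov_le hσ hlam hu hK)
          (hf.integrable r (ht.trans hr'.1))).trans
          (mul_le_mul_of_nonneg_left (hCt r hr') (mul_nonneg hD0 hK0)))
    refine hb.trans ?_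
    rw [abs_of_nonneg (sub_nonneg.2 hτ.1)]
    gcongr
    linarith [hτ.2]
  have hI := hf.integral_sub_eq hu hcu ht (add_nonneg ht hh)
  obtain ⟨M, hM⟩ := hLc.exists_bound_of_continuous hLu.continuous
  have hint := hf.intervalIntegrable hLu.continuous hM ht (add_nonneg ht hh)
  have e1 : |(∫ τ in t..t + h, ∫ v, kolmogorov σ lam u v * f τ v) -
      h * ∫ v, kolmogorov σ lam u v * f t v| ≤ D * K * |C| * h * h := by
    have : (h * ∫ v, kolmogorov σ lam u v * f t v) =
        ∫ τ in t..t + h, ∫ v, kolmogorov σ lam u v * f t v := by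
      rw [intervalIntegral.integral_const, smul_eq_mul, add_sub_cancel_left]
    rw [this, ← intervalIntegral.integral_sub hint intervalIntegrable_const]
    have hb := intervalIntegral.norm_integral_le_of_norm_le_const (a := t) (b := t + h)
      (f := fun τ => (∫ v, kolmogorov σ lam u v * f τ v) - ∫ v, kolmogorov σ lam u v * f t v)
      (C := D * K * |C| * h)
      (fun r hr => by
        rw [uIoc_of_le (by linarith)] at hr
        exact hlip r ⟨hr.1.le, hr.2⟩)
    rwa [add_sub_cancel_left, abs_of_nonneg hh] at hb
  have e2 : |(∫ v, walkStep σ lam h u v * f t v) - (∫ v, u v * f t v) -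
      h * ∫ v, kolmogorov σ lam u v * f t v| ≤ c * (h * √h) * K * |C| := by
    have : (∫ v, walkStep σ lam h u v * f t v) - (∫ v, u v * f t v) -
        h * ∫ v, kolmogorov σ lam u v * f t v =
        ∫ v, (walkStep σ lam h u v - u v - h * kolmogorov σ lam u v) * f t v := by
      have i1 := integrable_testFun_mul hWu hWc hft
      have i2 := integrable_testFun_mul hu hcu hft
      have i3 := integrable_testFun_mul hLu hLc hft
      have i12 : Integrable (fun v => walkStep σ lam h u v * f t v - u v * f t v) := i1.sub i2
      rw [← integral_const_mul, ← integral_sub i1 i2, ← integral_sub i12 (i3.const_mul h)]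
      congr 1 with v
      ring
    rw [this]
    exact (abs_integral_mul_le (hcons u K h hu hK hh h1 hlh) hft).trans
      (mul_le_mul_of_nonneg_left (hCt t ⟨le_rfl, by linarith⟩)
        (by have := Real.sqrt_nonneg h; positivity))
  have e3 : D * K * |C| * h * h ≤ D * K * |C| * (h * √h) := by
    rw [mul_assoc, ← sq]
    gcongr
  have split : (∫ v, u v * f (t + h) v) - ∫ v, walkStep σ lam h u v * f t v =
      ((∫ τ in t..t + h, ∫ v, kolmogorov σ lam u v * f τ v) -
        h * ∫ v, kolmogorov σ lam u v * f t v) -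
      ((∫ v, walkStep σ lam h u v * f t v) - (∫ v, u v * f t v) -
        h * ∫ v, kolmogorov σ lam u v * f t v) := by
    rw [← hI]; ring
  rw [split]
  refine (abs_sub _ _).trans ?_
  linarith

/-- The last time step is peeled off and moved onto the test function, so the induction must range
over all u: the hypothesis is used for `walkStep` of u with its enlarged constant. -/
lemma abs_iterate_le (hσ : 0 < σ) (hlam : 0 < lam) (hf : IsWeakSolution σ lam f₀ f) {T c : ℝ}
    (hc0 : 0 ≤ c)
    (hstep : ∀ (u : ℝ → ℝ) (K h t : ℝ), ContDiff ℝ ∞ u → HasCompactSupport u →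
      WeightedBound u K → 0 ≤ h → h ≤ 1 → lam * h ≤ 1 → 0 ≤ t → t + h ≤ T →
      |(∫ v, u v * f (t + h) v) - ∫ v, walkStep σ lam h u v * f t v| ≤ c * (h * √h) * K)
    {h : ℝ} (hh : 0 ≤ h) (h1 : h ≤ 1) (hlh : lam * h ≤ 1) (k : ℕ) :
    ∀ (u : ℝ → ℝ) (K : ℝ), ContDiff ℝ ∞ u → HasCompactSupport u → WeightedBound u K → k * h ≤ T →
      |(∫ v, u v * f (k * h) v) - ∫ v, (walkStep σ lam h)^[k] u v * f₀ v| ≤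
        k * (c * (h * √h)) * (Real.exp ((8 * σ + 4 * lam) * h) ^ k * K) := by
  have hc1 : 0 ≤ c * (h * √h) := by have := Real.sqrt_nonneg h; positivity
  induction k with
  | zero =>
    intro u K hu hcu _ _
    have := hf.weak u hu hcu 0 le_rfl
    simp [this]
  | succ k ih =>
    intro u K hu hcu hK hT
    have hkh : ((k + 1 : ℕ) : ℝ) * h = k * h + h := by push_cast; ring
    rw [hkh] at hT ⊢
    have hWu : ContDiff ℝ ∞ (walkStep σ lam h u) := contDiff_affineAvg hu _ _ _
    have hWc : HasCompactSupport (walkStep σ lam h u) :=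
      hasCompactSupport_affineAvg hcu (Real.exp_ne_zero _) (Real.exp_ne_zero _) _
    have h2 := ih _ _ hWu hWc (hK.walkStep hσ hlam hh hu) (by linarith)
    have h3 := hstep u K h (k * h) hu hcu hK hh h1 hlh (by positivity) hT
    set E := Real.exp ((8 * σ + 4 * lam) * h)
    have hE : 1 ≤ E ^ (k + 1) := one_le_pow₀ (Real.one_le_exp (by positivity))
    have h4 : c * (h * √h) * K ≤ c * (h * √h) * (E ^ (k + 1) * K) := by
      gcongr
      exact le_mul_of_one_le_left hK.nonneg hE
    rw [Function.iterate_succ_apply]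
    refine (abs_sub_le _ (∫ v, walkStep σ lam h u v * f (k * h) v) _).trans ?_
    push_cast
    calc _ ≤ c * (h * √h) * (E ^ (k + 1) * K) + k * (c * (h * √h)) * (E ^ k * (E * K)) :=
          add_le_add (h3.trans h4) h2
      _ = _ := by ring

/-- Weak solutions are the limits of the random walk, in the sense of distributions. -/
lemma tendsto_iterate_walkStep (hσ : 0 < σ) (hlam : 0 < lam) (hf : IsWeakSolution σ lam f₀ f)
    {t : ℝ} (ht : 0 ≤ t) {u : ℝ → ℝ} (hu : ContDiff ℝ ∞ u) (hcu : HasCompactSupport u) :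
    Filter.Tendsto (fun n : ℕ => ∫ v, (walkStep σ lam (t / n))^[n] u v * f₀ v) Filter.atTop
      (nhds (∫ v, u v * f t v)) := by
  obtain ⟨c, hc0, hstep⟩ := hf.exists_abs_step_le hσ hlam t
  obtain ⟨K, hK⟩ := exists_weightedBound hu hcu
  have hlim : Filter.Tendsto (fun n : ℕ => t / (n : ℝ)) Filter.atTop (nhds 0) :=
    tendsto_const_div_atTop_nhds_zero_nat t
  -- With h = t/n, the n errors of size c h^(3/2) add up to t c √(t/n), up to the exponential growth
  -- factor.
  have hbound : Filter.Tendsto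
      (fun n : ℕ => t * (c * √(t / n)) * (Real.exp ((8 * σ + 4 * lam) * t) * K))
      Filter.atTop (nhds 0) := by
    have := ((hlim.sqrt.const_mul c).const_mul t).mul_const
      (Real.exp ((8 * σ + 4 * lam) * t) * K)
    simpa using this
  rw [tendsto_iff_dist_tendsto_zero]
  refine squeeze_zero' (Filter.Eventually.of_forall fun _ => dist_nonneg) ?_ hbound
  have hl : Filter.Tendsto (fun n : ℕ => lam * (t / (n : ℝ))) Filter.atTop (nhds 0) := by
    simpa using hlim.const_mul lam
  filter_upwards [hlim.eventually_le_const zero_lt_one, hl.eventually_le_const zero_lt_one,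
    Filter.eventually_gt_atTop 0] with n h1 h2 hn
  have hn' : (n : ℝ) ≠ 0 := by positivity
  have hnt : (n : ℝ) * (t / n) = t := mul_div_cancel₀ t hn'
  have := hf.abs_iterate_le hσ hlam hc0 hstep (div_nonneg ht n.cast_nonneg) h1 h2 n u K hu hcu hK
    hnt.le
  rw [hnt, ← Real.exp_nat_mul, mul_left_comm (n : ℝ) (8 * σ + 4 * lam), hnt] at this
  rw [dist_comm, Real.dist_eq]
  refine this.trans (le_of_eq ?_)
  calc _ = ((n : ℝ) * (t / n)) * (c * √(t / n)) * (Real.exp ((8 * σ + 4 * lam) * t) * K) := by ring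
    _ = _ := by rw [hnt]

end IsWeakSolution

/-! ### Linearity, bounds and first moments of the iterated walk -/

section Iterates

variable {E : Type*} [AddCommGroup E] [Module ℝ E] {σ lam h : ℝ}

/-- With values in a general module, this one identity covers real and imaginary parts as well as
sums and differences, the latter as linear maps on pairs. -/
lemma walkStep_comp_linear {E' : Type*} [AddCommGroup E'] [Module ℝ E'] (l : E →ₗ[ℝ] E')
    (u : ℝ → E) : walkStep σ lam h (fun v => l (u v)) = fun v => l (walkStep σ lam h u v) := by
  ext v
  simp [walkStep, affineAvg]

lemma iterate_walkStep_comp_linear {E' : Type*} [AddCommGroup E'] [Module ℝ E'] (l : E →ₗ[ℝ] E')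
    (n : ℕ) (u : ℝ → E) :
    (walkStep σ lam h)^[n] (fun v => l (u v)) = fun v => l ((walkStep σ lam h)^[n] u v) := by
  induction n generalizing u with
  | zero => rfl
  | succ n ih => rw [Function.iterate_succ_apply, walkStep_comp_linear, ih]; rfl

lemma iterate_walkStep_sub (n : ℕ) (u w : ℝ → E) :
    (walkStep σ lam h)^[n] (fun v => u v - w v) =
      fun v => (walkStep σ lam h)^[n] u v - (walkStep σ lam h)^[n] w v := by
  have h1 := iterate_walkStep_comp_linear (σ := σ) (lam := lam) (h := h)
    (LinearMap.fst ℝ E E - LinearMap.snd ℝ E E) n (fun v => (u v, w v))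
  have h2 := iterate_walkStep_comp_linear (σ := σ) (lam := lam) (h := h)
    (LinearMap.fst ℝ E E) n (fun v => (u v, w v))
  have h3 := iterate_walkStep_comp_linear (σ := σ) (lam := lam) (h := h)
    (LinearMap.snd ℝ E E) n (fun v => (u v, w v))
  simp only [LinearMap.sub_apply, LinearMap.fst_apply, LinearMap.snd_apply] at h1 h2 h3
  rw [h1, h2, h3]

lemma continuous_iterate_walkStep {F : Type*} [NormedAddCommGroup F] [NormedSpace ℝ F] (n : ℕ)
    {u : ℝ → F} (hu : Continuous u) : Continuous ((walkStep σ lam h)^[n] u) := by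
  induction n generalizing u with
  | zero => exact hu
  | succ n ih =>
    refine ih ?_
    unfold walkStep affineAvg
    fun_prop

lemma norm_iterate_walkStep_le {F : Type*} [NormedAddCommGroup F] [NormedSpace ℝ F] (n : ℕ)
    {u : ℝ → F} {M : ℝ} (hu : ∀ v, ‖u v‖ ≤ M) (v : ℝ) : ‖(walkStep σ lam h)^[n] u v‖ ≤ M := by
  induction n generalizing u with
  | zero => exact hu v
  | succ n ih =>
    refine ih fun w => ?_
    rw [walkStep, affineAvg, norm_smul, Real.norm_of_nonneg (by norm_num : (0 : ℝ) ≤ 1 / 2)]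
    refine (mul_le_mul_of_nonneg_left ((norm_add_le _ _).trans (add_le_add (hu _) (hu _)))
      (by norm_num)).trans (le_of_eq (by ring))

lemma abs_iterate_walkStep_le (n : ℕ) {u : ℝ → ℝ} {M : ℝ} (hu : ∀ v, |u v| ≤ M) (v : ℝ) :
    |(walkStep σ lam h)^[n] u v| ≤ M :=
  norm_iterate_walkStep_le (F := ℝ) n hu v

/-- The random walk has mean displacement at most `lam h` per step. -/
lemma abs_iterate_walkStep_le_linear (hσ : 0 < σ) (hlam : 0 < lam) (hh : 0 ≤ h) (n : ℕ)
    {u : ℝ → ℝ} {R d : ℝ} (hu : ∀ v, R * |u v| ≤ |v| + d) (hR : 0 ≤ R) (v : ℝ) :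
    R * |(walkStep σ lam h)^[n] u v| ≤ |v| + (d + n * (lam * h)) := by
  induction n generalizing u d with
  | zero => simpa using hu v
  | succ n ih =>
    -- At p = 1 Itô's correction cancels the variance term, and the mean factor is at most e^(-λh).
    have h1 : 1 / 2 * (Real.exp (logScale σ lam h 1) + Real.exp (logScale σ lam h (-1))) ≤ 1 := by
      have := exp_logScale_rpow_avg_le lam 1 hσ hh
      simp only [Real.rpow_one] at this
      refine this.trans (Real.exp_le_one_iff.2 ?_)
      nlinarith [mul_nonneg hlam.le hh]
    have key := ih (u := walkStep σ lam h u) (d := d + lam * h) fun w => ?_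
    · refine key.trans (le_of_eq ?_)
      push_cast; ring
    · have hx (a : ℝ) (ha : 0 < a) : R * |u (a * w + lam * h)| ≤ a * |w| + lam * h + d := by
        refine (hu _).trans ?_
        gcongr
        refine (abs_add_le _ _).trans (le_of_eq ?_)
        rw [abs_mul, abs_of_pos ha, abs_of_nonneg (by positivity : 0 ≤ lam * h)]
      have e1 := hx _ (Real.exp_pos (logScale σ lam h 1))
      have e2 := hx _ (Real.exp_pos (logScale σ lam h (-1)))
      rw [walkStep, affineAvg, smul_eq_mul, abs_mul, abs_of_pos (by norm_num : (0 : ℝ) < 1 / 2)]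
      have e3 := mul_le_mul_of_nonneg_left (abs_add_le
        (u (Real.exp (logScale σ lam h 1) * w + lam * h))
        (u (Real.exp (logScale σ lam h (-1)) * w + lam * h))) hR
      have e4 := mul_le_mul_of_nonneg_right h1 (abs_nonneg w)
      nlinarith

end Iterates

/-! ### Passage to bounded test functions -/

/-- Uniform approximation allows exchanging the limits. -/
lemma tendsto_of_uniform_approx {a : ℕ → ℝ} {L : ℝ} {b : ℕ → ℕ → ℝ} {A e : ℕ → ℝ}
    (hb : ∀ m, Filter.Tendsto (b m) Filter.atTop (nhds (A m)))
    (hA : Filter.Tendsto A Filter.atTop (nhds L)) (he : Filter.Tendsto e Filter.atTop (nhds 0))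
    (hab : ∀ m n, |a n - b m n| ≤ e m) : Filter.Tendsto a Filter.atTop (nhds L) := by
  rw [Metric.tendsto_atTop]
  intro ε hε
  obtain ⟨m, hm1, hm2⟩ := ((Metric.tendsto_nhds.1 hA (ε / 3) (by positivity)).and
    (he.eventually_lt_const (by positivity : 0 < ε / 3))).exists
  obtain ⟨N, hN⟩ := Metric.tendsto_atTop.1 (hb m) (ε / 3) (by positivity)
  refine ⟨N, fun n hn => ?_⟩
  have h1 := hN n hn
  have h2 := hab m n
  rw [Real.dist_eq] at *
  have := abs_sub_le (a n) (b m n) L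
  have := abs_sub_le (b m n) (A m) L
  linarith

/-- A smooth cutoff function at scale `m + 1`. -/
def cutoff (m : ℕ) : ContDiffBump (0 : ℝ) :=
  ⟨m + 1, m + 2, by positivity, by linarith⟩

lemma cutoff_eq_one {m : ℕ} {v : ℝ} (hv : |v| ≤ m + 1) : cutoff m v = 1 :=
  (cutoff m).one_of_mem_closedBall (by simpa [cutoff] using hv)

lemma tendsto_cutoff (v : ℝ) : Filter.Tendsto (fun m => cutoff m v) Filter.atTop (nhds 1) := by
  refine tendsto_const_nhds.congr' ?_
  filter_upwards [Filter.eventually_ge_atTop ⌈|v|⌉₊] with m hm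
  refine (cutoff_eq_one ?_).symm
  have := (Nat.le_ceil |v|).trans (Nat.cast_le.2 hm)
  linarith

namespace IsWeakSolution

variable {σ lam : ℝ} {f₀ : ℝ → ℝ} {f : ℝ → ℝ → ℝ}

/-- The convergence of the random walk extends to bounded smooth functions, since no mass
escapes to infinity. -/
lemma tendsto_iterate_walkStep_of_bounded (hσ : 0 < σ) (hlam : 0 < lam) (h₀ : Integrable f₀)
    (hf : IsWeakSolution σ lam f₀ f) {t : ℝ} (ht : 0 ≤ t) {φ : ℝ → ℝ} (hφ : ContDiff ℝ ∞ φ)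
    (hφ1 : ∀ v, |φ v| ≤ 1) :
    Filter.Tendsto (fun n : ℕ => ∫ v, (walkStep σ lam (t / n))^[n] φ v * f₀ v) Filter.atTop
      (nhds (∫ v, φ v * f t v)) := by
  have hwd (m : ℕ) : ContDiff ℝ ∞ (fun v => φ v * cutoff m v) := hφ.mul (cutoff m).contDiff
  have hwc (m : ℕ) : HasCompactSupport (fun v => φ v * cutoff m v) :=
    (cutoff m).hasCompactSupport.mul_left
  have hw1 (m : ℕ) (v : ℝ) : |φ v * cutoff m v| ≤ 1 := by
    rw [abs_mul, abs_of_nonneg (cutoff m).nonneg]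
    exact mul_le_one₀ (hφ1 v) (cutoff m).nonneg (cutoff m).le_one
  -- The truncation error φ(1 - χ) is at most 1 and vanishes for |v| ≤ m + 1, hence is at most
  -- |v|/(m + 1). The walk turns this Markov-type bound into (|v| + λt)/(m + 1), uniformly in n. The
  -- minimum with 1 permits dominated convergence against |f₀| alone.
  refine tendsto_of_uniform_approx (fun m => hf.tendsto_iterate_walkStep hσ hlam ht (hwd m) (hwc m))
    (e := fun m => ∫ v, min 1 ((|v| + lam * t) / ((m : ℝ) + 1)) * |f₀ v|) ?_ ?_ ?_
  · refine tendsto_integral_of_dominated_convergence (fun v => |f t v|)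
      (fun m => ((hwd m).continuous.aestronglyMeasurable.mul (hf.integrable t ht).1))
      (hf.integrable t ht).abs (fun m => ae_of_all _ fun v => ?_) (ae_of_all _ fun v => ?_)
    · rw [norm_mul]
      exact mul_le_of_le_one_left (abs_nonneg _) (hw1 m v)
    · simpa using ((tendsto_cutoff v).const_mul (φ v)).mul_const (f t v)
  · have hz : (0 : ℝ) = ∫ v : ℝ, (0 : ℝ) := by simp
    rw [hz]
    refine tendsto_integral_of_dominated_convergence (fun v => |f₀ v|)
      (fun m => (Continuous.aestronglyMeasurable (by fun_prop)).mul h₀.abs.1)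
      h₀.abs (fun m => ae_of_all _ fun v => ?_) (ae_of_all _ fun v => ?_)
    · have : 0 ≤ min 1 ((|v| + lam * t) / ((m : ℝ) + 1)) := by positivity
      rw [Real.norm_eq_abs, abs_mul, abs_abs, abs_of_nonneg this]
      exact mul_le_of_le_one_left (abs_nonneg _) (min_le_left _ _)
    · have h1 : Filter.Tendsto (fun m : ℕ => (|v| + lam * t) / ((m : ℝ) + 1)) Filter.atTop
          (nhds 0) := by
        simpa [Function.comp_def] using
          (tendsto_const_div_atTop_nhds_zero_nat (|v| + lam * t)).comp
          (Filter.tendsto_add_atTop_nat 1)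
      simpa using (Filter.Tendsto.min (tendsto_const_nhds (x := (1 : ℝ))) h1).mul_const |f₀ v|
  · intro m n
    set h := t / n with hh
    have hh0 : 0 ≤ h := div_nonneg ht n.cast_nonneg
    have hnh : n * h ≤ t := by
      -- The estimate must hold for every n; for n = 0 the default value of t/0 gives h = 0.
      rcases Nat.eq_zero_or_pos n with rfl | hn
      · simpa using ht
      · exact (mul_div_cancel₀ t (by positivity)).le
    have hR : (0 : ℝ) < (m : ℝ) + 1 := by positivity
    have i1 := integrable_mul_of_bounded (continuous_iterate_walkStep (σ := σ) (lam := lam)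
      (h := h) n hφ.continuous) (abs_iterate_walkStep_le n hφ1) h₀
    have i2 := integrable_mul_of_bounded (continuous_iterate_walkStep (σ := σ) (lam := lam)
      (h := h) n (hwd m).continuous) (abs_iterate_walkStep_le n (hw1 m)) h₀
    rw [← integral_sub i1 i2, ← Real.norm_eq_abs]
    have hd1 (v : ℝ) : |φ v - φ v * cutoff m v| ≤ 1 := by
      rw [← mul_one_sub, abs_mul, abs_of_nonneg (sub_nonneg.2 (cutoff m).le_one)]
      exact mul_le_one₀ (hφ1 v) (sub_nonneg.2 (cutoff m).le_one)
        (sub_le_self _ (cutoff m).nonneg)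
    have hd2 (v : ℝ) : ((m : ℝ) + 1) * |φ v - φ v * cutoff m v| ≤ |v| + 0 := by
      rcases le_or_gt |v| (m + 1) with hv | hv
      · simp [cutoff_eq_one hv]
      · nlinarith [hd1 v]
    refine norm_integral_le_of_norm_le (h₀.abs.bdd_mul (c := 1)
      (Continuous.aestronglyMeasurable (by fun_prop)) (ae_of_all _ fun v => ?_))
      (ae_of_all _ fun v => ?_)
    · have : 0 ≤ min 1 ((|v| + lam * t) / ((m : ℝ) + 1)) := by positivity
      rw [Real.norm_eq_abs, abs_of_nonneg this]
      exact min_le_left _ _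
    · rw [← sub_mul, norm_mul, ← congrFun (iterate_walkStep_sub n φ _) v]
      refine mul_le_mul_of_nonneg_right (le_min (abs_iterate_walkStep_le n hd1 v) ?_)
        (abs_nonneg _)
      rw [le_div_iff₀ hR, mul_comm]
      refine (abs_iterate_walkStep_le_linear hσ hlam hh0 n hd2 hR.le v).trans ?_
      nlinarith

end IsWeakSolution

/-! ### The walk on the Fourier side -/

/-- The character `v ↦ e^{-iξv}`. -/
def negChar (ξ v : ℝ) : ℂ := Complex.exp (-(Complex.I * (ξ : ℂ) * (v : ℂ)))

/-- The adjoint of the random walk step, on the Fourier side. -/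
def fourierStep (σ lam h : ℝ) (G : ℝ → ℂ) (ξ : ℝ) : ℂ :=
  (1 / 2 : ℝ) • (negChar ξ (lam * h) * G (Real.exp (logScale σ lam h 1) * ξ) +
    negChar ξ (lam * h) * G (Real.exp (logScale σ lam h (-1)) * ξ))

lemma norm_negChar (ξ v : ℝ) : ‖negChar ξ v‖ = 1 := by
  simp [negChar, Complex.norm_exp]

lemma continuous_negChar (ξ : ℝ) : Continuous (negChar ξ) := by
  unfold negChar
  fun_prop

lemma contDiff_negChar (ξ : ℝ) : ContDiff ℝ ∞ (negChar ξ) := by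
  unfold negChar
  have : ContDiff ℝ ∞ (fun v : ℝ => (v : ℂ)) := Complex.ofRealCLM.contDiff
  exact (contDiff_const.mul this).neg.cexp

lemma integrable_mul_ofReal {Ψ : ℝ → ℂ} {g : ℝ → ℝ} (hc : Continuous Ψ) {M : ℝ}
    (hΨ : ∀ v, ‖Ψ v‖ ≤ M) (hg : Integrable g) : Integrable (fun v => Ψ v * (g v : ℂ)) :=
  hg.ofReal.bdd_mul hc.aestronglyMeasurable (ae_of_all _ hΨ)

lemma continuous_fourierTr {g : ℝ → ℝ} (hg : Integrable g) : Continuous (fourierTr g) := by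
  refine continuous_of_dominated (bound := fun v => |g v|) (fun ξ => ?_)
    (fun ξ => ae_of_all _ fun v => ?_) hg.abs (ae_of_all _ fun v => by fun_prop)
  · exact (integrable_mul_ofReal (continuous_negChar ξ)
      (fun v => (norm_negChar ξ v).le) hg).1
  · have := norm_negChar ξ v
    rw [negChar] at this
    rw [norm_mul, this, one_mul, Complex.norm_real, Real.norm_eq_abs]

lemma continuous_fourierStep {σ lam h : ℝ} {G : ℝ → ℂ} (hG : Continuous G) :
    Continuous (fourierStep σ lam h G) := by
  unfold fourierStep negChar
  fun_prop

lemma continuous_iterate_fourierStep {σ lam h : ℝ} (n : ℕ) {G : ℝ → ℂ} (hG : Continuous G) :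
    Continuous ((fourierStep σ lam h)^[n] G) := by
  induction n generalizing G with
  | zero => exact hG
  | succ n ih => exact ih (continuous_fourierStep hG)

lemma iterate_fourierStep_sub {σ lam h : ℝ} (n : ℕ) (G H : ℝ → ℂ) (ξ : ℝ) :
    (fourierStep σ lam h)^[n] (fun ξ => G ξ - H ξ) ξ =
      (fourierStep σ lam h)^[n] G ξ - (fourierStep σ lam h)^[n] H ξ := by
  induction n generalizing G H with
  | zero => rfl
  | succ n ih =>
    rw [Function.iterate_succ_apply, Function.iterate_succ_apply, Function.iterate_succ_apply, ← ih]
    refine congrArg (fun K => (fourierStep σ lam h)^[n] K ξ) (funext fun ζ => ?_)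
    simp only [fourierStep, ← smul_sub]
    congr 1
    ring

/-- An affine change of variable sends a character to a phase times the character of the dilated
frequency. -/
lemma walkStep_negChar (σ lam h ξ : ℝ) :
    walkStep σ lam h (negChar ξ) = fun v =>
      (1 / 2 : ℝ) •
        (negChar ξ (lam * h) * negChar (Real.exp (logScale σ lam h 1) * ξ) v +
          negChar ξ (lam * h) * negChar (Real.exp (logScale σ lam h (-1)) * ξ) v) := by
  ext v
  simp only [walkStep, affineAvg, negChar, ← Complex.exp_add]
  push_cast
  ring_nf

/-- Induction over all frequencies: the first walk step splits the character into two characters,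
which matches the outermost `fourierStep`. -/
lemma integral_iterate_walkStep_negChar (σ lam h : ℝ) (n : ℕ) {g : ℝ → ℝ}
    (hg : Integrable g) (ξ : ℝ) :
    ∫ v, (walkStep σ lam h)^[n] (negChar ξ) v * (g v : ℂ) =
      (fourierStep σ lam h)^[n] (fourierTr g) ξ := by
  induction n generalizing ξ with
  | zero => rfl
  | succ n ih =>
    set a₁ := Real.exp (logScale σ lam h 1) with h₁
    set a₂ := Real.exp (logScale σ lam h (-1)) with h₂
    set c := negChar ξ (lam * h) with hc
    have hi (ζ : ℝ) := integrable_mul_ofReal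
      (continuous_iterate_walkStep (σ := σ) (lam := lam) (h := h) n (continuous_negChar ζ))
      (norm_iterate_walkStep_le n fun v => (norm_negChar ζ v).le) hg
    have e := iterate_walkStep_comp_linear (σ := σ) (lam := lam) (h := h)
      ((1 / 2 : ℝ) • ((LinearMap.mul ℝ ℂ c).comp (LinearMap.fst ℝ ℂ ℂ) +
        (LinearMap.mul ℝ ℂ c).comp (LinearMap.snd ℝ ℂ ℂ))) n
      (fun v => (negChar (a₁ * ξ) v, negChar (a₂ * ξ) v))
    have e₁ := iterate_walkStep_comp_linear (σ := σ) (lam := lam) (h := h)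
      (LinearMap.fst ℝ ℂ ℂ) n (fun v => (negChar (a₁ * ξ) v, negChar (a₂ * ξ) v))
    have e₂ := iterate_walkStep_comp_linear (σ := σ) (lam := lam) (h := h)
      (LinearMap.snd ℝ ℂ ℂ) n (fun v => (negChar (a₁ * ξ) v, negChar (a₂ * ξ) v))
    simp only [LinearMap.smul_apply, LinearMap.add_apply, LinearMap.comp_apply,
      LinearMap.fst_apply, LinearMap.snd_apply, LinearMap.mul_apply'] at e e₁ e₂
    rw [Function.iterate_succ_apply, Function.iterate_succ_apply', walkStep_negChar, e,
      fourierStep, ← ih, ← ih, ← integral_const_mul, ← integral_const_mul,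
      ← integral_add ((hi _).const_mul _) ((hi _).const_mul _), ← integral_smul]
    congr 1 with v
    beta_reduce
    rw [← congrFun e₁ v, ← congrFun e₂ v, smul_mul_assoc]
    congr 1
    ring

lemma integral_mul_ofReal_eq {Ψ : ℝ → ℂ} {g : ℝ → ℝ} (hc : Continuous Ψ) {M : ℝ}
    (hΨ : ∀ v, ‖Ψ v‖ ≤ M) (hg : Integrable g) :
    ∫ v, Ψ v * (g v : ℂ) =
      ((∫ v, (Ψ v).re * g v : ℝ) : ℂ) + ((∫ v, (Ψ v).im * g v : ℝ) : ℂ) * Complex.I := by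
  rw [← integral_re_add_im (integrable_mul_ofReal hc hΨ hg)]
  simp

lemma IsWeakSolution.tendsto_iterate_fourierStep {σ lam : ℝ} {f₀ : ℝ → ℝ} {f : ℝ → ℝ → ℝ}
    (hσ : 0 < σ) (hlam : 0 < lam) (h₀ : Integrable f₀) (hf : IsWeakSolution σ lam f₀ f) {t : ℝ}
    (ht : 0 ≤ t) (ξ : ℝ) :
    Filter.Tendsto (fun n : ℕ => (fourierStep σ lam (t / n))^[n] (fourierTr f₀) ξ) Filter.atTop
      (nhds (fourierTr (f t) ξ)) := by
  have hn (v : ℝ) := (norm_negChar ξ v).le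
  have hr := hf.tendsto_iterate_walkStep_of_bounded hσ hlam h₀ ht
    (φ := fun v => (negChar ξ v).re)
    (Complex.reCLM.contDiff.comp (contDiff_negChar ξ))
    (fun v => (Complex.abs_re_le_norm _).trans (hn v))
  have hi := hf.tendsto_iterate_walkStep_of_bounded hσ hlam h₀ ht
    (φ := fun v => (negChar ξ v).im)
    (Complex.imCLM.contDiff.comp (contDiff_negChar ξ))
    (fun v => (Complex.abs_im_le_norm _).trans (hn v))
  have e : fourierTr (f t) ξ = _ :=
    integral_mul_ofReal_eq (continuous_negChar ξ) hn (hf.integrable t ht)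
  rw [e]
  have := ((Complex.continuous_ofReal.tendsto _).comp hr).add
    (((Complex.continuous_ofReal.tendsto _).comp hi).mul_const Complex.I)
  refine this.congr fun n => ?_
  rw [← integral_iterate_walkStep_negChar σ lam (t / n) n h₀ ξ,
    integral_mul_ofReal_eq (continuous_iterate_walkStep n (continuous_negChar ξ))
      (norm_iterate_walkStep_le n hn) h₀]
  have er := iterate_walkStep_comp_linear (σ := σ) (lam := lam) (h := t / n) Complex.reLm n
    (negChar ξ)
  have ei := iterate_walkStep_comp_linear (σ := σ) (lam := lam) (h := t / n) Complex.imLm n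
    (negChar ξ)
  simp only [Complex.reLm_coe, Complex.imLm_coe] at er ei
  simp only [Function.comp_apply, er, ei]

/-! ### Contraction in the weighted norm -/

/-- The weighted Fourier transform whose `L²` norm is the Fourier-based metric. -/
def sobolevWeight (s : ℝ) (G : ℝ → ℂ) (ξ : ℝ) : ℂ := |ξ| ^ (-(s + 1 / 2)) • G ξ

lemma aestronglyMeasurable_sobolevWeight (s : ℝ) {G : ℝ → ℂ} (hG : Continuous G) (μ : Measure ℝ) :
    AEStronglyMeasurable (sobolevWeight s G) μ := by
  have : Measurable fun ξ : ℝ => |ξ| ^ (-(s + 1 / 2)) := by fun_prop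
  exact this.aestronglyMeasurable.smul hG.aestronglyMeasurable

lemma fourierDist_eq_eLpNorm (s : ℝ) (g h : ℝ → ℝ) :
    fourierDist s 2 g h =
      eLpNorm (sobolevWeight s fun ξ => fourierTr g ξ - fourierTr h ξ) 2 volume := by
  rw [eLpNorm_eq_lintegral_rpow_enorm_toReal (by norm_num) (by norm_num), fourierDist]
  simp only [ENNReal.toReal_ofNat]
  congr 1
  refine lintegral_congr fun ξ => ?_
  rw [← ofReal_norm, ENNReal.ofReal_rpow_of_nonneg (norm_nonneg _) (by norm_num),
    sobolevWeight, norm_smul, Real.mul_rpow (norm_nonneg _) (norm_nonneg _),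
    Real.norm_of_nonneg (by positivity), ← Real.rpow_mul (abs_nonneg _)]
  ring_nf

lemma eLpNorm_comp_mul_left {H : ℝ → ℂ} (hH : ∀ μ : Measure ℝ, AEStronglyMeasurable H μ) {a : ℝ}
    (ha : 0 < a) :
    eLpNorm (fun ξ => H (a * ξ)) 2 volume =
      ENNReal.ofReal (a ^ (-(1 / 2) : ℝ)) * eLpNorm H 2 volume := by
  have h1 := eLpNorm_map_measure (p := 2) (hH (Measure.map (fun x => a * x) volume))
    (measurable_const_mul a).aemeasurable
  rw [Real.map_volume_mul_left ha.ne', eLpNorm_smul_measure_of_ne_top (by norm_num),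
    smul_eq_mul, abs_of_pos (inv_pos.2 ha)] at h1
  rw [show (fun ξ => H (a * ξ)) = H ∘ fun ξ => a * ξ from rfl, ← h1,
    ENNReal.ofReal_rpow_of_nonneg (by positivity) (by simp), Real.inv_rpow ha.le,
    Real.rpow_neg ha.le]
  norm_num

/-- The weight contributes a^(s + 1/2) and the Jacobian a^(-1/2); the phase has modulus one. -/
lemma eLpNorm_sobolevWeight_dilation (s : ℝ) {G : ℝ → ℂ} (hG : Continuous G) {a : ℝ}
    (ha : 0 < a) (c : ℝ → ℂ) (hc : ∀ ξ, ‖c ξ‖ = 1) :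
    eLpNorm (sobolevWeight s fun ξ => c ξ * G (a * ξ)) 2 volume =
      ENNReal.ofReal (a ^ s) * eLpNorm (sobolevWeight s G) 2 volume := by
  have h1 : eLpNorm (sobolevWeight s fun ξ => c ξ * G (a * ξ)) 2 volume =
      eLpNorm (a ^ (s + 1 / 2) • fun ξ => sobolevWeight s G (a * ξ)) 2 volume := by
    refine eLpNorm_congr_norm_ae (ae_of_all _ fun ξ => ?_)
    simp only [sobolevWeight, Pi.smul_apply, norm_smul, norm_mul, hc, one_mul]
    rw [abs_mul, abs_of_pos ha, Real.mul_rpow ha.le (abs_nonneg _), norm_mul,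
      Real.norm_of_nonneg (by positivity : 0 ≤ a ^ (s + 1 / 2)),
      Real.norm_of_nonneg (by positivity : 0 ≤ a ^ (-(s + 1 / 2))), ← mul_assoc, ← mul_assoc,
      ← Real.rpow_add ha, add_neg_cancel, Real.rpow_zero, one_mul]
  rw [h1, eLpNorm_const_smul, eLpNorm_comp_mul_left
    (aestronglyMeasurable_sobolevWeight s hG) ha, ← mul_assoc, Real.enorm_eq_ofReal (by positivity),
    ← ENNReal.ofReal_mul (by positivity), ← Real.rpow_add ha]
  ring_nf

/-- One step of the random walk contracts the Fourier-based metric. -/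
lemma eLpNorm_sobolevWeight_fourierStep_le {σ h : ℝ} (lam s : ℝ) (hσ : 0 < σ) (hh : 0 ≤ h)
    {G : ℝ → ℂ} (hG : Continuous G) :
    eLpNorm (sobolevWeight s (fourierStep σ lam h G)) 2 volume ≤
      ENNReal.ofReal (Real.exp (-(s * (lam + σ / 2) - s ^ 2 * σ / 2) * h)) *
        eLpNorm (sobolevWeight s G) 2 volume := by
  have hc : Continuous fun ξ => negChar ξ (lam * h) := by
    unfold negChar
    fun_prop
  have hm (a : ℝ) : AEStronglyMeasurable
      (sobolevWeight s fun ξ => negChar ξ (lam * h) * G (a * ξ)) volume :=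
    aestronglyMeasurable_sobolevWeight s (hc.mul (hG.comp (continuous_const_mul a))) volume
  have e : sobolevWeight s (fourierStep σ lam h G) = (1 / 2 : ℝ) •
      ((sobolevWeight s fun ξ =>
        negChar ξ (lam * h) * G (Real.exp (logScale σ lam h 1) * ξ)) +
      (sobolevWeight s fun ξ =>
        negChar ξ (lam * h) * G (Real.exp (logScale σ lam h (-1)) * ξ))) := by
    ext ξ
    simp only [sobolevWeight, fourierStep, Pi.smul_apply, Pi.add_apply, ← smul_add]
    rw [smul_comm]
  rw [e, eLpNorm_const_smul]
  refine (mul_le_mul_right (eLpNorm_add_le (hm _) (hm _) (by norm_num)) _).trans ?_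
  rw [eLpNorm_sobolevWeight_dilation s hG (Real.exp_pos _) _ fun ξ => norm_negChar ξ _,
    eLpNorm_sobolevWeight_dilation s hG (Real.exp_pos _) _ fun ξ => norm_negChar ξ _,
    ← add_mul, ← mul_assoc, ← ENNReal.ofReal_add (by positivity) (by positivity),
    Real.enorm_eq_ofReal (by norm_num), ← ENNReal.ofReal_mul (by norm_num)]
  gcongr
  exact exp_logScale_rpow_avg_le lam s hσ hh

lemma eLpNorm_sobolevWeight_iterate_fourierStep_le {σ h : ℝ} (lam s : ℝ) (hσ : 0 < σ)
    (hh : 0 ≤ h) (n : ℕ) {G : ℝ → ℂ} (hG : Continuous G) :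
    eLpNorm (sobolevWeight s ((fourierStep σ lam h)^[n] G)) 2 volume ≤
      ENNReal.ofReal (Real.exp (-(s * (lam + σ / 2) - s ^ 2 * σ / 2) * (n * h))) *
        eLpNorm (sobolevWeight s G) 2 volume := by
  induction n with
  | zero => simp
  | succ n ih =>
    rw [Function.iterate_succ_apply']
    refine (eLpNorm_sobolevWeight_fourierStep_le lam s hσ hh
      (continuous_iterate_fourierStep n hG)).trans ((mul_le_mul_right ih _).trans (le_of_eq ?_))
    rw [← mul_assoc, ← ENNReal.ofReal_mul (Real.exp_pos _).le, ← Real.exp_add]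
    push_cast
    ring_nf

/-! ### Stationarity of the equilibrium -/

/-- The substitution y = 1/v turns the integrand into the Gamma integrand y^(μ - 1) e^(-my). -/
lemma integrableOn_exp_neg_div_rpow {m μ : ℝ} (hm : 0 < m) (hμ : 0 < μ) :
    IntegrableOn (fun v => Real.exp (-(m / v)) / v ^ (1 + μ)) (Ioi 0) := by
  have h := (integrableOn_Ioi_comp_rpow_iff'
    (fun y : ℝ => y ^ (μ - 1) * Real.exp (-m * y ^ (1 : ℝ))) (p := -1) (by norm_num)).2
    (integrableOn_rpow_mul_exp_neg_mul_rpow (by linarith) one_pos hm)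
  refine h.congr_fun (fun v (hv : 0 < v) => ?_) measurableSet_Ioi
  simp only [Real.rpow_one, smul_eq_mul]
  rw [← Real.rpow_mul hv.le, ← mul_assoc, ← Real.rpow_add hv, Real.rpow_neg_one, mul_comm,
    div_eq_mul_inv, ← Real.rpow_neg hv.le]
  congr 2 <;> ring

section Equilibrium

variable {σ lam : ℝ}

lemma paretoExp_sub_one_pos (hσ : 0 < σ) (hlam : 0 < lam) : 0 < paretoExp σ lam - 1 := by
  rw [paretoExp, add_sub_cancel_left]
  positivity

lemma equilibrium_eq_indicator (σ lam : ℝ) : equilibrium σ lam = (Ioi 0).indicator fun v =>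
    (paretoExp σ lam - 1) ^ paretoExp σ lam / Real.Gamma (paretoExp σ lam) *
      (Real.exp (-((paretoExp σ lam - 1) / v)) / v ^ (1 + paretoExp σ lam)) := by
  ext v
  simp [equilibrium, indicator_apply]

lemma integrable_equilibrium (hσ : 0 < σ) (hlam : 0 < lam) : Integrable (equilibrium σ lam) := by
  have hm := paretoExp_sub_one_pos hσ hlam
  rw [equilibrium_eq_indicator, integrable_indicator_iff measurableSet_Ioi]
  exact (integrableOn_exp_neg_div_rpow hm (by linarith)).const_mul _

/-- The function `v ^ 2 * exp (- m / v) / v ^ (2 + m)`, proportional to `v ^ 2` times the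
equilibrium, tends to zero at the origin. -/
lemma tendsto_exp_neg_div_mul_rpow {m : ℝ} (hm : 0 < m) :
    Filter.Tendsto (fun v : ℝ => Real.exp (-(m / v)) * v ^ (-m)) (nhdsWithin 0 (Ioi 0))
      (nhds 0) := by
  refine ((tendsto_rpow_mul_exp_neg_mul_atTop_nhds_zero m m hm).comp
    tendsto_inv_nhdsGT_zero).congr' ?_
  filter_upwards [self_mem_nhdsWithin] with v (hv : 0 < v)
  rw [Function.comp_apply, Real.inv_rpow hv.le, Real.rpow_neg hv.le, mul_comm, div_eq_mul_inv,
    neg_mul]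

/-- For m = 2λ/σ this is, up to a constant factor, the zero-flux relation (σ/2)(v² f∞)' = -λ(v - 1)
f∞. -/
lemma hasDerivAt_exp_neg_div_mul_rpow (m : ℝ) {v : ℝ} (hv : 0 < v) :
    HasDerivAt (fun v : ℝ => Real.exp (-(m / v)) * v ^ (-m))
      (-(m * (v - 1)) * (Real.exp (-(m / v)) / v ^ (1 + (1 + m)))) v := by
  have h1 : HasDerivAt (fun v : ℝ => -(m / v)) (m / v ^ 2) v := by
    have := ((hasDerivAt_inv hv.ne').const_mul m).neg
    simp only [← div_eq_mul_inv] at this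
    exact this.congr_deriv (by ring)
  refine (h1.exp.mul (Real.hasDerivAt_rpow_const (Or.inl hv.ne'))).congr_deriv ?_
  have e1 : v ^ (-m) = v ^ 2 / v ^ (1 + (1 + m)) := by
    rw [← Real.rpow_natCast, ← Real.rpow_sub hv]
    congr 1
    push_cast
    ring
  have e2 : v ^ (-m - 1) = v / v ^ (1 + (1 + m)) := by
    nth_rewrite 2 [← Real.rpow_one v]
    rw [← Real.rpow_sub hv]
    congr 1
    ring
  rw [e1, e2]
  have : 0 < v ^ (1 + (1 + m)) := by positivity
  field_simp
  ring

/-- The equilibrium is annihilated by the adjoint of the Kolmogorov operator. -/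
lemma integral_kolmogorov_mul_equilibrium (hσ : 0 < σ) (hlam : 0 < lam) {φ : ℝ → ℝ}
    (hφ : ContDiff ℝ ∞ φ) (hc : HasCompactSupport φ) :
    ∫ v, kolmogorov σ lam φ v * equilibrium σ lam v = 0 := by
  have hm := paretoExp_sub_one_pos hσ hlam
  have hint := integrable_testFun_mul (contDiff_kolmogorov σ lam hφ)
    (hasCompactSupport_kolmogorov σ lam hc) (integrable_equilibrium hσ hlam)
  set m := paretoExp σ lam - 1 with hmdef
  have hμ : paretoExp σ lam = 1 + m := by rw [hmdef]; ring
  have hmσ : σ * m = 2 * lam := by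
    rw [hmdef, paretoExp]
    field_simp
    ring
  set C := m ^ paretoExp σ lam / Real.Gamma (paretoExp σ lam) with hC
  have hind : (fun v => kolmogorov σ lam φ v * equilibrium σ lam v) = (Ioi 0).indicator fun v =>
      kolmogorov σ lam φ v * (C * (Real.exp (-(m / v)) / v ^ (1 + (1 + m)))) := by
    ext v
    rw [equilibrium_eq_indicator, ← hmdef, ← hC, hμ]
    simp only [indicator_apply]
    split_ifs <;> simp
  rw [hind, integrable_indicator_iff measurableSet_Ioi] at hint
  rw [hind, integral_indicator measurableSet_Ioi]
  -- W is (σ/2) v² f∞ φ'. By zero flux it is a primitive of (Lφ) f∞ on the half-line, and it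
  -- vanishes at both ends.
  let W : ℝ → ℝ := fun v => C * (σ / 2) * (Real.exp (-(m / v)) * v ^ (-m) * deriv φ v)
  have hφ' : ContDiff ℝ ∞ (deriv φ) := hφ.iterate_deriv 1
  -- The default values at v = 0 give `0 ^ (-m) = 0`, in agreement with the limit from the right.
  have hW0 : W 0 = 0 := by simp [W, Real.zero_rpow (neg_ne_zero.2 hm.ne')]
  have hWcont : ContinuousWithinAt W (Ici 0) 0 := by
    rw [← continuousWithinAt_Ioi_iff_Ici, ContinuousWithinAt, hW0]
    have := ((tendsto_exp_neg_div_mul_rpow hm).mul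
      (hφ'.continuous.continuousWithinAt (s := Ioi 0) (x := 0))).const_mul (C * (σ / 2))
    simpa using this
  have hWtop : Filter.Tendsto W Filter.atTop (nhds 0) := by
    refine tendsto_const_nhds.congr' ?_
    have h0 := hc.deriv
    rw [hasCompactSupport_iff_eventuallyEq, Filter.coclosedCompact_eq_cocompact] at h0
    filter_upwards [atTop_le_cocompact h0] with v hv
    simp [W, show deriv φ v = 0 from hv]
  refine (integral_Ioi_of_hasDerivAt_of_tendsto hWcont (fun v (hv : 0 < v) => ?_) hint
    hWtop).trans (by rw [hW0, sub_zero])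
  have hd : HasDerivAt (deriv φ) (deriv (deriv φ) v) v :=
    (hφ'.differentiable (by simp) v).hasDerivAt
  refine (((hasDerivAt_exp_neg_div_mul_rpow m hv).mul hd).const_mul (C * (σ / 2))).congr_deriv ?_
  have e1 : v ^ (-m) = v ^ 2 / v ^ (1 + (1 + m)) := by
    rw [← Real.rpow_natCast, ← Real.rpow_sub hv]
    congr 1
    push_cast
    ring
  rw [e1, kolmogorov]
  linear_combination (-C / 2 * (v - 1) * (Real.exp (-(m / v)) / v ^ (1 + (1 + m))) *
    deriv φ v) * hmσ

/-- The equilibrium is a stationary weak solution. -/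
lemma isWeakSolution_equilibrium (hσ : 0 < σ) (hlam : 0 < lam) :
    IsWeakSolution σ lam (equilibrium σ lam) (fun _ => equilibrium σ lam) where
  measurable := (integrable_equilibrium hσ hlam).1.comp_snd
  integrable _ _ := integrable_equilibrium hσ hlam
  bounded _ := ⟨_, fun _ _ => le_rfl⟩
  weak φ hφ hc t _ := by
    have := integral_kolmogorov_mul_equilibrium hσ hlam hφ hc
    simp only [kolmogorov] at this
    simp [this]

end Equilibrium

end

/-! ### Conclusion -/

theorem theorem3p1 (σ lam s : ℝ) (hσ : 0 < σ) (hlam : 0 < lam)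
    (hs : 0 < s) (hsμ : s < paretoExp σ lam)
    (f₀ : ℝ → ℝ) (hf₀ : IsUnitMeanDensity f₀)
    (hfin : fourierDist s 2 f₀ (equilibrium σ lam) < ⊤)
    (f : ℝ → ℝ → ℝ) (hf : IsWeakSolution σ lam f₀ f) :
    0 < s / 2 * ((1 - s) * σ + 2 * lam) ∧
      ∀ t : ℝ, 0 ≤ t →
        fourierDist s 2 (f t) (equilibrium σ lam) ≤
          ENNReal.ofReal (Real.exp (-(s / 2 * ((1 - s) * σ + 2 * lam)) * t)) *
            fourierDist s 2 f₀ (equilibrium σ lam) := by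
  constructor
  · have h1 : s * σ < σ + 2 * lam := by
      rw [paretoExp] at hsμ
      calc s * σ < (1 + 2 * (lam / σ)) * σ := by gcongr
        _ = σ + 2 * lam := by field_simp
    have : 0 < (1 - s) * σ + 2 * lam := by linarith
    positivity
  · intro t ht
    have hE := integrable_equilibrium hσ hlam
    rw [fourierDist_eq_eLpNorm, fourierDist_eq_eLpNorm]
    set G : ℝ → ℂ := fun ξ => fourierTr f₀ ξ - fourierTr (equilibrium σ lam) ξ with hG
    have hGc : Continuous G :=
      (continuous_fourierTr hf₀.integrable).sub (continuous_fourierTr hE)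
    have hlim (ξ : ℝ) : Filter.Tendsto
        (fun n : ℕ => sobolevWeight s ((fourierStep σ lam (t / n))^[n] G) ξ) Filter.atTop
        (nhds (sobolevWeight s
          (fun ξ => fourierTr (f t) ξ - fourierTr (equilibrium σ lam) ξ) ξ)) := by
      refine Filter.Tendsto.const_smul ?_ _
      simp only [hG, iterate_fourierStep_sub]
      exact (hf.tendsto_iterate_fourierStep hσ hlam hf₀.integrable ht ξ).sub
        ((isWeakSolution_equilibrium hσ hlam).tendsto_iterate_fourierStep hσ hlam hE ht ξ)
    -- Fatou's lemma: pointwise convergence in ξ suffices, since each n > 0 satisfies the final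
    -- bound with the exact rate.
    refine (Lp.eLpNorm_lim_le_liminf_eLpNorm (fun n => aestronglyMeasurable_sobolevWeight s
      (continuous_iterate_fourierStep n hGc) _) _ (ae_of_all _ hlim)).trans ?_
    refine Filter.liminf_le_of_frequently_le' (Filter.Eventually.frequently ?_)
    filter_upwards [Filter.eventually_gt_atTop 0] with n hn
    refine (eLpNorm_sobolevWeight_iterate_fourierStep_le lam s hσ
      (div_nonneg ht n.cast_nonneg) n hGc).trans (le_of_eq ?_)
    rw [mul_div_cancel₀ t (by positivity : (n : ℝ) ≠ 0)]
    ring_nf
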